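/- **Setting.** A tensor $A=(A^s)_{s}$ of complex $D\times D$ matrices ($D\ge 1$, $s$ ranging over a finite non-empty set of physical basis states) defines on every periodic chain of $n$ sites the MPS with wave function $\operatorname{Tr}(A^{s_1}\cdots A^{s_n})$. It is *injective* if the transfer matrix $\sum_s A^s\otimes \overline{A^s}$ has a non-degenerate dominant eigenvalue, all other eigenvalues being strictly smaller in modulus, with positive definite left and right dominant eigenvectors; it is *left-canonical* if $\sum_s (A^s)^\dagger A^s=1$. We write $\doteq$ for equality up to a phase. Let $G=\prod_{I=1}^r \mathbb Z_{N_I}$ with $N_I\ge 1$, let $a_I\in\mathbb Z$ be coprime to $N_I$, $N_{IJ}=\gcd(N_I,N_J)$, $n_{IJ}\in\mathbb Z$, and let $U_I$ be on-site unitaries with $U_I^{N_I}\doteq 1$ and $$U_IU_J=e^{2\pi i n_{IJ}/N_{IJ}}\,U_JU_I\qquad (I<J).$$ Let $L\ge1$ with $U_I^{a_I^L}\doteq U_I$. The exponential symmetries are $\mathcal U_I=\bigotimes_{j=1}^L U_I^{a_I^{j-1}}$. An MPS is *symmetric* if for all $m\ge1$ and all $I$ the MPS on $mL$ sites is an eigenstate,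 with eigenvalue a phase, of the $m$-fold periodic extension of $\mathcal U_I$. The *$\mathbb Z_N$ qudit chain* is the case $G=\mathbb Z_N\times\mathbb Z_N$ with physical space $\mathbb C^N$, generators $Z^n$ and $X$ (clock and shift, $ZX=e^{2\pi i/N}XZ$), i.e. $\mathcal U_z=\bigotimes_j Z_j^{nb^{j-1}}$ and $\mathcal U_x=\bigotimes_j X_j^{a^{j-1}}$, where $a,b$ are coprime to $N$; there $N_{IJ}=N$, $n_{IJ}=n$, $a_Ia_J=ab$. **(1) Bond class.** Let $A$ be an injective, left-canonical, symmetric MPS tensor. There are bond unitaries $v_I$ such that for all $I$ and all $j\ge1$ $$U_I^{a_I^{j-1}}\cdot A\doteq (v_I^\dagger)^{a_I^{j-1}}\,A\,v_I^{a_I^{j}} .$$ For any such $v$ and every bond $j\ge0$, the ordered products $V_j(g)=\prod_I v_I^{a_I^jg_I}$ form a projective representation of $G$, with a cocycle $\omega_j$, where $V_j(g)V_j(h)=\omega_j(g,h)V_j(gh)$. For each pair $I<J$ there is an integer $k_{IJ}$, the same for all choices of $v$, such that for all $j\ge 0$ $$\omega_j(g_I,g_J)\,\omega_j(g_J,g_I)^{-1}=v_I^{a_I^j}v_J^{a_J^j}v_I^{-a_I^j}v_J^{-a_J^j}=e^{2\pi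 i k_{IJ}(a_Ia_J)^j/N_{IJ}},$$ and $$k_{IJ}(a_Ia_J-1)\equiv n_{IJ}\pmod{N_{IJ}} .$$ In particular, on the qudit chain a bond class $k$ with $k(ab-1)\equiv n \pmod N$ is required, where $v_zv_x=e^{2\pi i k/N}v_xv_z$. **(2) Solutions.** For integers $M\ge1$, $q$, $n$ and $c=\gcd(q-1,M)$, the congruence $k(q-1)\equiv n\pmod M$ has a solution iff $c\mid n$. In that case $\frac{q-1}{c}$ has an inverse $u$ modulo $M/c$, and for every such $u$ an integer $k$ is a solution iff $k\equiv \frac nc\,u+\tau\frac Mc \pmod M$ for a (then unique) $\tau\in\{0,\dots,c-1\}$. If $c=1$, then every solution is $\not\equiv0\pmod M$ iff $n\not\equiv 0\pmod M$. (This is applied with $M=N$, $q=ab$ and with $M=N_{IJ}$, $q=a_Ia_J$.) **(3) LSM.** If $c_{IJ}=\gcd(a_Ia_J-1,N_{IJ})$ does not divide $n_{IJ}$ for some pair $I<J$ (on the qudit chain: if $c=\gcd(ab-1,N)\nmid n$), then no injective MPS, of any bond dimension and in any gauge, is symmetric. **(4) SPT-LSM.** If for some pair $I<J$ every solution $k$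 of $k(a_Ia_J-1)\equiv n_{IJ}\pmod{N_{IJ}}$ satisfies $k\not\equiv0\pmod{N_{IJ}}$ (on the qudit chain: every solution of $k(ab-1)\equiv n\pmod N$ has $k\not\equiv 0 \pmod N$), then there is an SPT-LSM obstruction: for every injective, left-canonical, symmetric MPS tensor, any $v$ as in (1) and every bond $j$, the class $[\omega_j]\in H^2(G,U(1))$ is non-trivial. If $c=1$, the qudit chain has this SPT-LSM obstruction exactly when $n\not\equiv0\pmod N$; if $c_{IJ}=1$ for all $I<J$, the general system has it exactly when $n_{IJ}\not\equiv0\pmod{N_{IJ}}$ for some pair $I<J$. -/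

import Mathlib

open scoped BigOperators Matrix

noncomputable section

namespace ModulatedMPS

open scoped ComplexOrder

variable {σ : Type*} [Fintype σ] [DecidableEq σ] {D r : ℕ}

/-- A translation-invariant MPS tensor: physical index `σ`, bond dimension `D`. -/
abbrev Tensor (σ : Type*) (D : ℕ) : Type _ := σ → Matrix (Fin D) (Fin D) ℂ

/-- The action `u · A` of an on-site operator on the physical leg of the tensor. -/
def act (u : Matrix σ σ ℂ) (A : Tensor σ D) : Tensor σ D :=
  fun s => ∑ t, u s t • A t

/-- The wave function `Tr (A^{s_1} ⋯ A^{s_n})` of the periodic MPS on `n` sites. -/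
def amplitude (A : Tensor σ D) (n : ℕ) (s : Fin n → σ) : ℂ :=
  ((List.ofFn fun j => A (s j)).prod).trace

/-- The operator `⊗_j u_j` on the `n`-site Hilbert space, acting on wave functions. -/
def chainOp {n : ℕ} (u : Fin n → Matrix σ σ ℂ) (ψ : (Fin n → σ) → ℂ) : (Fin n → σ) → ℂ :=
  fun s => ∑ t : Fin n → σ, (∏ j, u j (s j) (t j)) * ψ t

/-- The transfer matrix `∑_s A^s ⊗ (A^s)^*`, as a map acting on bond matrices from the left. -/
def transfer (A : Tensor σ D) (X : Matrix (Fin D) (Fin D) ℂ) : Matrix (Fin D) (Fin D) ℂ :=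
  ∑ s, A s * X * (A s)ᴴ

/-- The same transfer matrix acting on left eigenvectors. -/
def transferDual (A : Tensor σ D) (X : Matrix (Fin D) (Fin D) ℂ) : Matrix (Fin D) (Fin D) ℂ :=
  ∑ s, (A s)ᴴ * X * A s

/-- Injectivity: the transfer matrix has a unique (non-degenerate) dominant eigenvalue,
all other eigenvalues being strictly smaller in modulus, and its left and right dominant
eigenvectors are positive definite (full rank). No gauge is fixed. -/
def IsInjective (A : Tensor σ D) : Prop :=
  0 < D ∧ ∃ (lam : ℝ) (ρ l : Matrix (Fin D) (Fin D) ℂ),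
    0 < lam ∧ ρ.PosDef ∧ l.PosDef ∧
    transfer A ρ = (lam : ℂ) • ρ ∧ transferDual A l = (lam : ℂ) • l ∧
    ∀ (μ : ℂ) (X : Matrix (Fin D) (Fin D) ℂ), X ≠ 0 → transfer A X = μ • X →
      ‖μ‖ < lam ∨ (μ = (lam : ℂ) ∧ ∃ c : ℂ, X = c • ρ)

/-- Left-canonical normalization `∑_s (A^s)† A^s = 1`. -/
def IsLeftCanonical (A : Tensor σ D) : Prop :=
  ∑ s, (A s)ᴴ * A s = 1

/-- Equality up to a phase. -/
def EqPhase {m : Type*} (X Y : Matrix m m ℂ) : Prop :=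
  ∃ φ : Circle, X = (φ : ℂ) • Y

/-- The on-site unitary `u ^ (a ^ j)` of an exponential symmetry, `j = 0, 1, 2, …` counting the
sites from the first one (so that the first site carries `u`, the second `u ^ a`, …). -/
def siteOp (u : Matrix.unitaryGroup σ ℂ) (a : ℤ) (j : ℕ) : Matrix σ σ ℂ :=
  ((u ^ (a ^ j) : Matrix.unitaryGroup σ ℂ) : Matrix σ σ ℂ)

/-- Compatibility with periodic boundary conditions on `L` sites: `u ^ (a ^ L) = u`
up to a phase. -/
def IsPeriodic (L : ℕ) (u : Matrix.unitaryGroup σ ℂ) (a : ℤ) : Prop :=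
  EqPhase (siteOp u a L) (u : Matrix σ σ ℂ)

/-- The MPS is symmetric under all the exponential symmetries `⊗_{j<L} U_I ^ (a_I ^ j)`: for every
`m ≥ 1` the periodic MPS on `m L` sites is an eigenstate (with a phase as eigenvalue) of the
`m`-fold periodic extension of the symmetry operator. -/
def IsSymmetric (L : ℕ) (a : Fin r → ℤ) (U : Fin r → Matrix.unitaryGroup σ ℂ)
    (A : Tensor σ D) : Prop :=
  ∀ I : Fin r, ∀ m : ℕ, 0 < m → ∃ φ : Circle, ∀ s : Fin (m * L) → σ,
    chainOp (fun j : Fin (m * L) => siteOp (U I) (a I) ((j : ℕ) % L)) (amplitude A (m * L)) s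
      = (φ : ℂ) * amplitude A (m * L) s

/-- `v` is a family of bond unitaries for the symmetries: on every site `j`,
`U_I ^ (a_I ^ j) · A ≐ (v_I†) ^ (a_I ^ j) A v_I ^ (a_I ^ (j + 1))`. -/
def PushesThrough (a : Fin r → ℤ) (U : Fin r → Matrix.unitaryGroup σ ℂ) (A : Tensor σ D)
    (v : Fin r → Matrix.unitaryGroup (Fin D) ℂ) : Prop :=
  ∀ (I : Fin r) (j : ℕ), ∃ φ : Circle, ∀ s : σ,
    act (siteOp (U I) (a I) j) A s
      = (φ : ℂ) • ((siteOp (v I) (a I) j)ᴴ * A s * siteOp (v I) (a I) (j + 1))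

/-- The operators `V_j(g) = ∏_I v_I ^ (a_I ^ j g_I)` (ordered product), `g ∈ ∏_I ℤ/N_I`, by which
the symmetry group acts on bond `j`, bond `0` being the one to the left of the first site. -/
def bondOp (N : Fin r → ℕ) (a : Fin r → ℤ) (v : Fin r → Matrix.unitaryGroup (Fin D) ℂ) (j : ℕ)
    (g : ∀ I, ZMod (N I)) : Matrix.unitaryGroup (Fin D) ℂ :=
  (List.ofFn fun I => v I ^ (a I ^ j * ((g I).val : ℤ))).prod

/-- `V(g) V(h) = ω(g,h) V(g + h)` : `V` is a projective representation with cocycle `ω`. -/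
def HasCocycle {G : Type*} [Add G] (V : G → Matrix.unitaryGroup (Fin D) ℂ)
    (ω : G → G → Circle) : Prop :=
  ∀ g h : G, (V g : Matrix (Fin D) (Fin D) ℂ) * (V h : Matrix (Fin D) (Fin D) ℂ)
    = (ω g h : ℂ) • (V (g + h) : Matrix (Fin D) (Fin D) ℂ)

/-- `ω` represents the trivial class of `H²(G, U(1))`. -/
def IsCoboundary {G : Type*} [Add G] (ω : G → G → Circle) : Prop :=
  ∃ β : G → Circle, ∀ g h : G, ω g h = β g * β h * (β (g + h))⁻¹

/-- The phase `exp (2 π i k / M)`. -/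
def rootPhase (M : ℕ) (k : ℤ) : Circle :=
  Circle.exp (2 * Real.pi * (k : ℝ) / (M : ℝ))

/-- `k` is the bond class of the generators `I`, `J` for the bond unitaries `v`: on every
bond `j` the invariant `ω_j(g_I,g_J) ω_j(g_J,g_I)⁻¹`, which is the commutator phase of
`v_I ^ (a_I ^ j)` and `v_J ^ (a_J ^ j)`, equals `exp (2 π i k (a_I a_J) ^ j / M)`. For `j = 0`
this reads `v_I v_J = exp (2 π i k / M) v_J v_I`. -/
def IsBondClass (N : Fin r → ℕ) (a : Fin r → ℤ) (v : Fin r → Matrix.unitaryGroup (Fin D) ℂ)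
    (I J : Fin r) (M : ℕ) (k : ℤ) : Prop :=
  ∀ j : ℕ,
    siteOp (v I) (a I) j * siteOp (v J) (a J) j
      = (rootPhase M (k * (a I * a J) ^ j) : ℂ) •
          (siteOp (v J) (a J) j * siteOp (v I) (a I) j) ∧
    ∀ ω : (∀ K, ZMod (N K)) → (∀ K, ZMod (N K)) → Circle, HasCocycle (bondOp N a v j) ω →
      ω (Pi.single I 1) (Pi.single J 1) * (ω (Pi.single J 1) (Pi.single I 1))⁻¹
        = rootPhase M (k * (a I * a J) ^ j)

/-- `k (q - 1) ≡ n (mod M)`. -/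
def SolvesBondEquation (M : ℕ) (q n k : ℤ) : Prop :=
  k * (q - 1) ≡ n [ZMOD (M : ℤ)]

/-- LSM obstruction: no injective MPS, of any bond dimension, is symmetric. -/
def LSMObstruction (L : ℕ) (a : Fin r → ℤ) (U : Fin r → Matrix.unitaryGroup σ ℂ) : Prop :=
  ∀ (D : ℕ) (A : Tensor σ D), IsInjective A → ¬ IsSymmetric L a U A

/-- SPT-LSM obstruction (obstruction to a trivial SPT): for every symmetric injective MPS, in
left-canonical form, the projective class carried by each virtual bond is non-trivial. -/
def SPTLSMObstruction (L : ℕ) (N : Fin r → ℕ) (a : Fin r → ℤ)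
    (U : Fin r → Matrix.unitaryGroup σ ℂ) : Prop :=
  ∀ (D : ℕ) (A : Tensor σ D), IsInjective A → IsLeftCanonical A → IsSymmetric L a U A →
    ∀ v : Fin r → Matrix.unitaryGroup (Fin D) ℂ, PushesThrough a U A v →
      ∀ (j : ℕ) (ω : (∀ K, ZMod (N K)) → (∀ K, ZMod (N K)) → Circle),
        HasCocycle (bondOp N a v j) ω → ¬ IsCoboundary ω

/-- The shift matrix `X |t⟩ = |t + 1⟩` of an `N`-level qudit. -/
def shiftMatrix (N : ℕ) : Matrix (ZMod N) (ZMod N) ℂ :=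
  Matrix.of fun s t => if s = t + 1 then 1 else 0

/-- The clock matrix `Z |s⟩ = exp (2 π i s / N) |s⟩` of an `N`-level qudit. -/
def clockMatrix (N : ℕ) : Matrix (ZMod N) (ZMod N) ℂ :=
  Matrix.diagonal fun s => (rootPhase N (s.val : ℤ) : ℂ)

theorem shiftMatrix_mem (N : ℕ) [NeZero N] :
    shiftMatrix N ∈ Matrix.unitaryGroup (ZMod N) ℂ := by
  rw [Matrix.mem_unitaryGroup_iff]
  ext s t
  simp only [shiftMatrix, Matrix.star_eq_conjTranspose, Matrix.mul_apply, Matrix.of_apply,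
    Matrix.conjTranspose_apply]
  rw [Finset.sum_eq_single (s - 1)]
  · by_cases h : s = t
    · simp [h, Matrix.one_apply]
    · simp [h, Ne.symm h]
  · intro x _ hx
    have : s ≠ x + 1 := fun h => hx (by rw [h]; ring)
    simp [this]
  · simp

theorem clockMatrix_mem (N : ℕ) [NeZero N] :
    clockMatrix N ∈ Matrix.unitaryGroup (ZMod N) ℂ := by
  rw [Matrix.mem_unitaryGroup_iff, Matrix.star_eq_conjTranspose, clockMatrix,
    Matrix.diagonal_conjTranspose, Matrix.diagonal_mul_diagonal, ← Matrix.diagonal_one]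
  congr 1
  ext s
  have h : ‖(rootPhase N (s.val : ℤ) : ℂ)‖ = 1 := Circle.norm_coe _
  simp only [Pi.star_apply, RCLike.star_def, Complex.mul_conj, Complex.normSq_eq_norm_sq, h]
  simp

/-- The shift as a unitary. -/
def shift (N : ℕ) [NeZero N] : Matrix.unitaryGroup (ZMod N) ℂ := ⟨shiftMatrix N, shiftMatrix_mem N⟩

/-- The clock as a unitary. -/
def clock (N : ℕ) [NeZero N] : Matrix.unitaryGroup (ZMod N) ℂ := ⟨clockMatrix N, clockMatrix_mem N⟩

/-- The two on-site generators of the qudit chain: index `0` is `Z ^ n`, index `1` is `X`. -/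
def quditGen (N : ℕ) [NeZero N] (n : ℤ) : Fin 2 → Matrix.unitaryGroup (ZMod N) ℂ :=
  ![clock N ^ n, shift N]

end ModulatedMPS

end

open ModulatedMPS

/-! For a left-canonical injective tensor `A`, the powers of the transfer matrix E converge to a
rank-one projector built from the stationary state ρ (`tendsto_transfer_iterate`). Let F be the
product, over one period, of the mixed transfer matrices of `A` with its images under the on-site
symmetry operators. Symmetry of the state says that tr F^m equals tr E^(mL) up to a phase. The
latter tends to 1, so F has a left eigenvector with eigenvalue of modulus at least 1. Each mixed
transfer matrix contracts the ρ-weighted norm, and equality forces an intertwining relation. Pulling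
the eigenvector along the chain therefore yields bond matrices which, suitably scaled, are unitary
(`IsStationary.exists_unitary_seq`).

The same convergence makes bond unitaries unique up to phases (`IsStationary.eq_scalar_of_mem`).
Hence they inherit, up to phases, the relations among the on-site operators: the next bond carries
the `a I`-th power, `N I`-th powers are scalar, and commutators are scalar. The quadruples (phase,
on-site unitary, left bond, right bond) form a group, `pushGroup`. In it the commutator of the
elements for I and J is (1, c, d, d^(a_I a_J)) with scalar entries, and comparing phases gives
d^(a_I a_J - 1) = c (`IsStationary.commutator_phase`). As d is an N_IJ-th root of unity, this is the
bond equation.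

The LSM obstruction is insolubility of this equation, after passing to a left-canonical gauge
(`IsInjective.exists_gauge`). For the SPT-LSM obstruction, a coboundary on an abelian group is
symmetric, so a trivial class would force the bond class to vanish. Conversely, if all on-site
commutators are trivial, a common eigenvector of the generators gives a symmetric product state with
trivial class (`not_sptLSMObstruction_of_commute`). -/

namespace ModulatedMPS

open scoped ComplexOrder Matrix Kronecker
open Filter Topology

/-! ### Decay of matrix powers from the spectrum. -/

section MatrixPowers

variable {n : Type*} [Fintype n] [DecidableEq n]

attribute [local instance] Matrix.linftyOpNormedRing Matrix.linftyOpNormedAlgebra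

/-- The powers of a complex matrix all of whose eigenvalues lie in the open unit disc tend to 0. -/
theorem tendsto_matrix_pow_zero (M : Matrix n n ℂ)
    (h : ∀ (μ : ℂ) (x : n → ℂ), x ≠ 0 → M *ᵥ x = μ • x → ‖μ‖ < 1) :
    Tendsto (fun k : ℕ => M ^ k) atTop (𝓝 0) := by
  -- In dimension zero the spectrum is empty, so no eigenvalue attains the spectral radius.
  cases isEmpty_or_nonempty n
  · exact tendsto_const_nhds.congr fun k => Subsingleton.elim _ _
  have hrad : spectralRadius ℂ M < 1 := by
    obtain ⟨z, hz, hzr⟩ := spectrum.exists_nnnorm_eq_spectralRadius M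
    rw [← hzr]
    have hdet : (algebraMap ℂ (Matrix n n ℂ) z - M).det = 0 := by
      by_contra hne
      exact hz ((Matrix.isUnit_iff_isUnit_det _).2 (isUnit_iff_ne_zero.2 hne))
    obtain ⟨x, hx, hxz⟩ := Matrix.exists_mulVec_eq_zero_iff.2 hdet
    have hMx : M *ᵥ x = z • x := by
      rw [Matrix.sub_mulVec, Algebra.algebraMap_eq_smul_one, Matrix.smul_mulVec,
        Matrix.one_mulVec, sub_eq_zero] at hxz
      exact hxz.symm
    have := h z x hx hMx
    exact_mod_cast (show ‖z‖₊ < 1 from this)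
  obtain ⟨r, hr, hr1⟩ := ENNReal.lt_iff_exists_nnreal_btwn.1 hrad
  have hr1' : r < 1 := by exact_mod_cast hr1
  -- Gelfand's formula turns a spectral radius below r into the geometric bound r^k.
  have hev := (spectrum.pow_nnnorm_pow_one_div_tendsto_nhds_spectralRadius M).eventually_lt_const hr
  have hbound : ∀ᶠ k : ℕ in atTop, ‖M ^ k‖ ≤ (r : ℝ) ^ k := by
    filter_upwards [hev, eventually_gt_atTop 0] with k hk hk0
    have hk' : (‖M ^ k‖₊ : ENNReal) ≤ (r : ENNReal) ^ k := by
      have := ENNReal.rpow_le_rpow hk.le (Nat.cast_nonneg (α := ℝ) k)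
      rw [← ENNReal.rpow_mul, one_div, inv_mul_cancel₀ (by positivity), ENNReal.rpow_one,
        ENNReal.rpow_natCast] at this
      exact this
    have h2 : ‖M ^ k‖₊ ≤ r ^ k := by exact_mod_cast hk'
    exact_mod_cast h2
  refine tendsto_zero_iff_norm_tendsto_zero.2 ?_
  exact squeeze_zero' (Eventually.of_forall fun k => norm_nonneg _) hbound
    (tendsto_pow_atTop_nhds_zero_of_lt_one r.2 hr1')

end MatrixPowers

/-- A matrix whose powers do not become traceless has a left eigenvector whose eigenvalue is not in
the open unit disc. -/
theorem exists_vecMul_eigenvector {n : Type*} [Fintype n] [DecidableEq n] (M : Matrix n n ℂ)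
    (h : ¬ Tendsto (fun k : ℕ => (M ^ k).trace) atTop (𝓝 0)) :
    ∃ (μ : ℂ) (x : n → ℂ), x ≠ 0 ∧ x ᵥ* M = μ • x ∧ 1 ≤ ‖μ‖ := by
  by_contra! hc
  apply h
  have h1 : Tendsto (fun k : ℕ => Mᵀ ^ k) atTop (𝓝 0) :=
    tendsto_matrix_pow_zero Mᵀ fun μ x hx hμ => hc μ x hx (by rwa [Matrix.mulVec_transpose] at hμ)
  have h2 : Tendsto (fun k : ℕ => (Mᵀ ^ k).trace) atTop (𝓝 (0 : Matrix n n ℂ).trace) :=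
    ((continuous_id.matrix_trace).tendsto _).comp h1
  simpa [← Matrix.transpose_pow] using h2

/-! ### Vectorised transfer matrices and their limit. -/

section Transfer

variable {σ : Type*} [Fintype σ] {D : ℕ}

/-- The mixed transfer matrix `∑_s (A^s)^* ⊗ B^s`. -/
def mixedTransfer (A B : Tensor σ D) : Matrix (Fin D × Fin D) (Fin D × Fin D) ℂ :=
  ∑ s, ((A s).map (starRingEnd ℂ)) ⊗ₖ B s

theorem mixedTransfer_mulVec_vec (A B : Tensor σ D) (X : Matrix (Fin D) (Fin D) ℂ) :
    mixedTransfer A B *ᵥ X.vec = (∑ s, B s * X * (A s)ᴴ).vec := by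
  rw [mixedTransfer, Matrix.sum_mulVec, Matrix.vec_sum]
  refine Finset.sum_congr rfl fun s _ => ?_
  rw [Matrix.kronecker_mulVec_vec]
  rfl

/-- Since `vec` stacks columns, the transposes are what turns the action on row vectors into the
dual map X ↦ ∑ A† X B. -/
theorem vec_vecMul_mixedTransfer (A B : Tensor σ D) (X : Matrix (Fin D) (Fin D) ℂ) :
    Xᵀ.vec ᵥ* mixedTransfer A B = (∑ s, (A s)ᴴ * X * B s)ᵀ.vec := by
  rw [mixedTransfer, Matrix.vecMul_sum, Matrix.transpose_sum, Matrix.vec_sum]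
  refine Finset.sum_congr rfl fun s _ => ?_
  rw [Matrix.vec_vecMul_kronecker, Matrix.transpose_mul, Matrix.transpose_mul, ← mul_assoc]
  rfl

/-- The powers of the transfer matrix converge to the projector on its dominant eigenvector. -/
theorem tendsto_transfer_iterate {A : Tensor σ D} (hA : IsLeftCanonical A)
    {ρ : Matrix (Fin D) (Fin D) ℂ} (hρ : transfer A ρ = ρ) (htr : ρ.trace = 1)
    (hspec : ∀ (μ : ℂ) (X : Matrix (Fin D) (Fin D) ℂ), X ≠ 0 → transfer A X = μ • X →
      ‖μ‖ < 1 ∨ (μ = 1 ∧ ∃ c : ℂ, X = c • ρ)) :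
    Tendsto (fun k : ℕ => mixedTransfer A A ^ k) atTop
      (𝓝 (Matrix.vecMulVec ρ.vec (1 : Matrix (Fin D) (Fin D) ℂ).vec)) := by
  set E := mixedTransfer A A
  set P := Matrix.vecMulVec ρ.vec (1 : Matrix (Fin D) (Fin D) ℂ).vec with hP
  have hE1 : (1 : Matrix (Fin D) (Fin D) ℂ).vec ᵥ* E = (1 : Matrix (Fin D) (Fin D) ℂ).vec := by
    have := vec_vecMul_mixedTransfer A A 1
    simp only [Matrix.transpose_one, mul_one] at this
    rw [this, hA, Matrix.transpose_one]
  have hEρ : E *ᵥ ρ.vec = ρ.vec := by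
    rw [mixedTransfer_mulVec_vec]; exact congrArg _ hρ
  have h1ρ : (1 : Matrix (Fin D) (Fin D) ℂ).vec ⬝ᵥ ρ.vec = 1 := by
    rw [Matrix.vec_dotProduct_vec]; simpa using htr
  have hPE : P * E = P := by rw [hP, Matrix.vecMulVec_mul, hE1]
  have hEP : E * P = P := by rw [hP, Matrix.mul_vecMulVec, hEρ]
  have hPP : P * P = P := by
    rw [hP, Matrix.vecMulVec_mul_vecMulVec, h1ρ, one_smul]
  have hPρ : P *ᵥ ρ.vec = ρ.vec := by
    rw [hP, Matrix.vecMulVec_mulVec, h1ρ]; simp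
  -- Subtracting the spectral projector removes the eigenvalue 1. The exponent starts at 1 because
  -- the zeroth power is the identity, not 1 - P.
  have hpow : ∀ k : ℕ, (E - P) ^ (k + 1) = E ^ (k + 1) - P := by
    intro k
    induction k with
    | zero => simp
    | succ k ih =>
      have hEkP : E ^ (k + 1) * P = P := by
        clear ih
        induction k with
        | zero => simpa using hEP
        | succ k ih => rw [pow_succ, mul_assoc, hEP, ih]
      rw [pow_succ, ih, sub_mul, mul_sub, mul_sub, hEkP, hPE, hPP, ← pow_succ]
      simp
  have hlim : Tendsto (fun k : ℕ => (E - P) ^ k) atTop (𝓝 0) := by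
    refine tendsto_matrix_pow_zero _ fun μ x hx hμ => ?_
    by_cases hμ0 : μ = 0
    · simp [hμ0]
    -- P annihilates E - P, so an eigenvector with nonzero eigenvalue lies in ker P. There E and E -
    -- P agree, and multiples of ρ are excluded.
    have hPx : P *ᵥ x = 0 := by
      have : P *ᵥ ((E - P) *ᵥ x) = 0 := by
        rw [Matrix.mulVec_mulVec, mul_sub, hPE, hPP, sub_self, Matrix.zero_mulVec]
      rw [hμ, Matrix.mulVec_smul] at this
      exact (smul_eq_zero.1 this).resolve_left hμ0
    have hEx : E *ᵥ x = μ • x := by rw [← hμ, Matrix.sub_mulVec, hPx, sub_zero]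
    obtain ⟨X, rfl⟩ := Matrix.vec_bijective.2 x
    have hX : X ≠ 0 := fun h => hx (by rw [h, Matrix.vec_zero])
    rw [mixedTransfer_mulVec_vec, ← Matrix.vec_smul, Matrix.vec_inj] at hEx
    rcases hspec μ X hX hEx with h | ⟨-, c, rfl⟩
    · exact h
    · rw [Matrix.vec_smul, Matrix.mulVec_smul, hPρ, ← Matrix.vec_smul, Matrix.vec_eq_zero_iff]
        at hPx
      exact absurd hPx hX
  have h2 : Tendsto (fun k : ℕ => (E - P) ^ (k + 1) + P) atTop (𝓝 (0 + P)) :=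
    ((tendsto_add_atTop_iff_nat 1).2 hlim).add_const P
  rw [zero_add] at h2
  refine (tendsto_add_atTop_iff_nat 1).1 (h2.congr fun k => ?_)
  rw [hpow, sub_add_cancel]

end Transfer

/-! ### Amplitudes and overlaps on periodic chains. -/

section Chain

variable {σ : Type*} [Fintype σ] {D : ℕ}

theorem list_prod_ofFn_sum {R : Type*} [CommSemiring R] {A : Type*} [Semiring A] [Algebra R A]
    {n : ℕ} (f : Fin n → σ → A) :
    (List.ofFn fun j => ∑ t, f j t).prod = ∑ t : Fin n → σ, (List.ofFn fun j => f j (t j)).prod := by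
  have := (MultilinearMap.mkPiAlgebraFin R n A).map_sum f
  simpa [MultilinearMap.mkPiAlgebraFin_apply] using this

theorem list_prod_ofFn_smul {R : Type*} [CommSemiring R] {A : Type*} [Semiring A] [Algebra R A]
    {n : ℕ} (c : Fin n → R) (f : Fin n → A) :
    (List.ofFn fun j => c j • f j).prod = (∏ j, c j) • (List.ofFn f).prod := by
  have := (MultilinearMap.mkPiAlgebraFin R n A).map_smul_univ c f
  simpa [MultilinearMap.mkPiAlgebraFin_apply] using this

/-- A tensor product of on-site operators can be absorbed site by site into the tensors, by
multilinearity of the ordered product. -/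
theorem chainOp_amplitude {n : ℕ} (u : Fin n → Matrix σ σ ℂ) (A : Tensor σ D) (s : Fin n → σ) :
    chainOp u (amplitude A n) s = (List.ofFn fun j => act (u j) A (s j)).prod.trace := by
  simp only [act, chainOp, amplitude]
  rw [list_prod_ofFn_sum (R := ℂ), Matrix.trace_sum]
  refine Finset.sum_congr rfl fun t _ => ?_
  rw [list_prod_ofFn_smul, Matrix.trace_smul, smul_eq_mul]

theorem list_prod_ofFn_kronecker {n : ℕ} (P Q : Fin n → Matrix (Fin D) (Fin D) ℂ) :
    (List.ofFn fun j => (P j).map (starRingEnd ℂ) ⊗ₖ Q j).prod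
      = ((List.ofFn P).prod.map (starRingEnd ℂ)) ⊗ₖ (List.ofFn Q).prod := by
  induction n with
  | zero => simp
  | succ n ih =>
    rw [List.ofFn_succ, List.ofFn_succ (f := P), List.ofFn_succ (f := Q), List.prod_cons,
      List.prod_cons, List.prod_cons, ih, Matrix.map_mul, Matrix.mul_kronecker_mul]

/-- The overlap of two matrix product states is the trace of a product of mixed transfer
matrices. -/
theorem sum_conj_amplitude_mul {n : ℕ} (A : Tensor σ D) (B : Fin n → Tensor σ D) :
    ∑ s : Fin n → σ, starRingEnd ℂ (amplitude A n s) * (List.ofFn fun j => B j (s j)).prod.trace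
      = (List.ofFn fun j => mixedTransfer A (B j)).prod.trace := by
  simp only [mixedTransfer]
  rw [list_prod_ofFn_sum (R := ℂ), Matrix.trace_sum]
  refine Finset.sum_congr rfl fun s _ => ?_
  rw [list_prod_ofFn_kronecker, Matrix.trace_kronecker, amplitude, AddMonoidHom.map_trace]

/-- The chain splits into m identical blocks; this turns the overlap on m periods into tr F^m. -/
theorem list_prod_ofFn_mod {M : Type*} [Monoid M] (m L : ℕ) (f : ℕ → M) :
    (List.ofFn fun j : Fin (m * L) => f ((j : ℕ) % L)).prod
      = (List.ofFn fun j : Fin L => f j).prod ^ m := by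
  have hf : ∀ (i : Fin m) (j : Fin L), f (((i : ℕ) * L + j) % L) = f j := fun i j => by
    rw [mul_comm, Nat.mul_add_mod, Nat.mod_eq_of_lt j.2]
  rw [List.ofFn_mul]
  simp only [hf]
  rw [List.prod_flatten, List.map_ofFn]
  simp [Function.comp_def, List.ofFn_const]

end Chain

/-! ### Invariance of transfer maps under on-site unitaries. -/

section Unitary

variable {σ : Type*} [Fintype σ] [DecidableEq σ] {D : ℕ}

/-- Orthonormality of the columns of u collapses the double sum to its diagonal. -/
theorem sum_unitary_smul {V : Type*} [AddCommGroup V] [Module ℂ V]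
    {u : Matrix σ σ ℂ} (hu : u ∈ Matrix.unitaryGroup σ ℂ) (F : σ → σ → V) :
    ∑ s, ∑ t, ∑ t', (u s t * star (u s t')) • F t t' = ∑ t, F t t := by
  have h : ∀ t t', ∑ s, u s t * star (u s t') = if t' = t then 1 else 0 := fun t t' => by
    have := congrFun (congrFun (Matrix.mem_unitaryGroup_iff'.1 hu) t') t
    rw [Matrix.mul_apply, Matrix.one_apply] at this
    rw [← this]
    exact Finset.sum_congr rfl fun s _ => mul_comm _ _
  rw [Finset.sum_comm]
  refine Finset.sum_congr rfl fun t _ => ?_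
  rw [Finset.sum_comm]
  simp_rw [← Finset.sum_smul, h]
  simp

theorem transfer_act {u : Matrix σ σ ℂ} (hu : u ∈ Matrix.unitaryGroup σ ℂ)
    (A : Tensor σ D) (X : Matrix (Fin D) (Fin D) ℂ) :
    transfer (act u A) X = transfer A X := by
  rw [transfer, transfer, ← sum_unitary_smul hu fun t t' => A t * X * (A t')ᴴ]
  refine Finset.sum_congr rfl fun s _ => ?_
  simp only [act, Matrix.conjTranspose_sum, Finset.sum_mul, Finset.mul_sum,
    Matrix.conjTranspose_smul, smul_mul_assoc, mul_smul_comm, Finset.smul_sum, smul_smul]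
  rw [Finset.sum_comm]
  simp only [mul_comm]

theorem transferDual_act {u : Matrix σ σ ℂ} (hu : u ∈ Matrix.unitaryGroup σ ℂ)
    (A : Tensor σ D) (X : Matrix (Fin D) (Fin D) ℂ) :
    transferDual (act u A) X = transferDual A X := by
  rw [transferDual, transferDual, ← sum_unitary_smul hu fun t t' => (A t')ᴴ * X * A t]
  refine Finset.sum_congr rfl fun s _ => ?_
  simp only [act, Matrix.conjTranspose_sum, Finset.sum_mul, Finset.mul_sum,
    Matrix.conjTranspose_smul, smul_mul_assoc, mul_smul_comm, Finset.smul_sum, smul_smul]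

end Unitary

/-! ### The stationary state and the norm it defines. -/

section Stationary

variable {σ : Type*} [Fintype σ] {D : ℕ}

/-- `ρ` is the normalized stationary state of a left-canonical injective tensor. -/
structure IsStationary (A : Tensor σ D) (ρ : Matrix (Fin D) (Fin D) ℂ) : Prop where
  leftCanonical : IsLeftCanonical A
  posDef : ρ.PosDef
  fixed : transfer A ρ = ρ
  trace_eq_one : ρ.trace = 1
  spectral : ∀ (μ : ℂ) (X : Matrix (Fin D) (Fin D) ℂ), X ≠ 0 → transfer A X = μ • X →
    ‖μ‖ < 1 ∨ (μ = 1 ∧ ∃ c : ℂ, X = c • ρ)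

theorem trace_transfer_mul (A : Tensor σ D) (X Y : Matrix (Fin D) (Fin D) ℂ) :
    (transfer A X * Y).trace = (X * transferDual A Y).trace := by
  simp only [transfer, transferDual, Finset.sum_mul, Finset.mul_sum, Matrix.trace_sum]
  refine Finset.sum_congr rfl fun s _ => ?_
  rw [mul_assoc, mul_assoc, Matrix.trace_mul_comm]
  simp only [mul_assoc]

theorem IsLeftCanonical.transferDual_one {A : Tensor σ D} (hA : IsLeftCanonical A) :
    transferDual A 1 = 1 := by
  have h : ∑ s, (A s)ᴴ * A s = 1 := hA
  simpa [transferDual] using h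

theorem IsLeftCanonical.trace_transfer {A : Tensor σ D} (hA : IsLeftCanonical A)
    (X : Matrix (Fin D) (Fin D) ℂ) : (transfer A X).trace = X.trace := by
  simpa [hA.transferDual_one] using trace_transfer_mul A X 1

/-- A left-canonical transfer map preserves the trace, and the trace of a positive definite
eigenvector is nonzero, so the dominant eigenvalue is 1. It remains to scale ρ to trace one. -/
theorem exists_isStationary {A : Tensor σ D} (hinj : IsInjective A) (hA : IsLeftCanonical A) :
    ∃ ρ, IsStationary A ρ := by
  obtain ⟨hD, lam, ρ, l, hlam, hρ, -, hρf, -, hspec⟩ := hinj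
  have : Nonempty (Fin D) := ⟨⟨0, hD⟩⟩
  have htr : 0 < ρ.trace := hρ.trace_pos
  have hlam1 : lam = 1 := by
    have h := hA.trace_transfer ρ
    rw [hρf, Matrix.trace_smul, smul_eq_mul, mul_eq_right₀ htr.ne'] at h
    exact_mod_cast h
  subst hlam1
  simp only [Complex.ofReal_one, one_smul] at hρf hspec
  have hinv : 0 < ρ.trace⁻¹ := inv_pos.2 htr
  refine ⟨ρ.trace⁻¹ • ρ, hA, hρ.smul hinv, ?_, ?_, fun μ X hX hμ => ?_⟩
  · simp only [transfer, mul_smul_comm, smul_mul_assoc, ← Finset.smul_sum]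
    exact congrArg _ hρf
  · rw [Matrix.trace_smul, smul_eq_mul, inv_mul_cancel₀ htr.ne']
  · rcases hspec μ X hX hμ with h | ⟨h, c, rfl⟩
    · exact Or.inl h
    · exact Or.inr ⟨h, c * ρ.trace, by rw [smul_smul, mul_assoc, mul_inv_cancel₀ htr.ne', mul_one]⟩

variable {A : Tensor σ D} {ρ : Matrix (Fin D) (Fin D) ℂ}

theorem IsStationary.nonempty (h : IsStationary A ρ) : Nonempty (Fin D) := by
  by_contra hne
  rw [not_nonempty_iff] at hne
  have := h.trace_eq_one
  simp [Matrix.trace] at this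

theorem IsStationary.exists_ne_zero (h : IsStationary A ρ) : ∃ s, A s ≠ 0 := by
  by_contra! h0
  have := h.nonempty
  have h1 : ∑ s, (A s)ᴴ * A s = 1 := h.leftCanonical
  simp [h0] at h1

theorem IsStationary.tendsto_mixedTransfer_pow (h : IsStationary A ρ) :
    Tendsto (fun k : ℕ => mixedTransfer A A ^ k) atTop
      (𝓝 (Matrix.vecMulVec ρ.vec (1 : Matrix (Fin D) (Fin D) ℂ).vec)) :=
  tendsto_transfer_iterate h.leftCanonical h.fixed h.trace_eq_one h.spectral

/-- The trace of the limiting projector is tr ρ. Physically, the squared norm of the periodic state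
tends to 1. -/
theorem IsStationary.tendsto_trace (h : IsStationary A ρ) :
    Tendsto (fun k : ℕ => (mixedTransfer A A ^ k).trace) atTop (𝓝 1) := by
  have h2 := ((continuous_id.matrix_trace).tendsto _).comp h.tendsto_mixedTransfer_pow
  have h3 : (Matrix.vecMulVec ρ.vec (1 : Matrix (Fin D) (Fin D) ℂ).vec).trace = 1 := by
    rw [Matrix.trace_vecMulVec, Matrix.vec_dotProduct_vec]
    simpa using h.trace_eq_one
  simpa [h3, Function.comp_def] using h2

theorem vec_vecMul_mixedTransfer_pow (A : Tensor σ D) (Y : Matrix (Fin D) (Fin D) ℂ) (k : ℕ) :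
    Yᵀ.vec ᵥ* mixedTransfer A A ^ k = ((transferDual A)^[k] Y)ᵀ.vec := by
  induction k generalizing Y with
  | zero => simp
  | succ k ih =>
    rw [pow_succ', ← Matrix.vecMul_vecMul, vec_vecMul_mixedTransfer, Function.iterate_succ_apply]
    exact ih _

/-- The iterates of the dual transfer matrix converge to the expectation value in the stationary
state. -/
theorem IsStationary.tendsto_iterate (h : IsStationary A ρ) (Y : Matrix (Fin D) (Fin D) ℂ) :
    Tendsto (fun k : ℕ => (transferDual A)^[k] Y) atTop (𝓝 ((Y * ρ).trace • 1)) := by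
  have h1 : Tendsto (fun k : ℕ => Yᵀ.vec ᵥ* mixedTransfer A A ^ k) atTop
      (𝓝 (Yᵀ.vec ᵥ* Matrix.vecMulVec ρ.vec (1 : Matrix (Fin D) (Fin D) ℂ).vec)) :=
    ((continuous_const.matrix_vecMul continuous_id).tendsto _).comp h.tendsto_mixedTransfer_pow
  have h2 : Yᵀ.vec ᵥ* Matrix.vecMulVec ρ.vec (1 : Matrix (Fin D) (Fin D) ℂ).vec
      = ((Y * ρ).trace • (1 : Matrix (Fin D) (Fin D) ℂ))ᵀ.vec := by
    rw [Matrix.vecMul_vecMulVec, Matrix.vec_dotProduct_vec, Matrix.transpose_transpose,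
      Matrix.transpose_smul, Matrix.transpose_one, Matrix.vec_smul]
  simp only [vec_vecMul_mixedTransfer_pow, h2] at h1
  rw [tendsto_pi_nhds] at h1
  refine tendsto_pi_nhds.2 fun i => tendsto_pi_nhds.2 fun j => ?_
  exact h1 (i, j)

/-- The squared norm of `Y` in the stationary state. -/
def weight (ρ Y : Matrix (Fin D) (Fin D) ℂ) : ℝ :=
  (Y * ρ * Yᴴ).trace.re

theorem weight_nonneg (hρ : ρ.PosDef) (Y : Matrix (Fin D) (Fin D) ℂ) : 0 ≤ weight ρ Y :=
  (Complex.nonneg_iff.1 (hρ.posSemidef.mul_mul_conjTranspose_same Y).trace_nonneg).1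

theorem weight_eq_zero (hρ : ρ.PosDef) {Y : Matrix (Fin D) (Fin D) ℂ} (hY : weight ρ Y = 0) :
    Y = 0 := by
  have hps := hρ.posSemidef.mul_mul_conjTranspose_same Y
  have h0 : (Y * ρ * Yᴴ).trace = 0 :=
    Complex.ext hY (Complex.nonneg_iff.1 hps.trace_nonneg).2.symm
  rw [hps.trace_eq_zero_iff] at h0
  rw [← Matrix.conjTranspose_eq_zero]
  refine Matrix.ext_of_mulVec_single fun i => ?_
  by_contra hne
  have hne' : Yᴴ *ᵥ Pi.single i 1 ≠ 0 := fun h => hne (by rw [h, Matrix.zero_mulVec])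
  have := hρ.dotProduct_mulVec_pos hne'
  rw [Matrix.star_mulVec, Matrix.conjTranspose_conjTranspose, ← Matrix.dotProduct_mulVec,
    Matrix.mulVec_mulVec, Matrix.mulVec_mulVec, h0] at this
  simp at this

theorem weight_smul (c : ℂ) (Y : Matrix (Fin D) (Fin D) ℂ) :
    weight ρ (c • Y) = ‖c‖ ^ 2 * weight ρ Y := by
  rw [weight, weight, Matrix.conjTranspose_smul, smul_mul_assoc, smul_mul_assoc, mul_smul_comm,
    smul_smul, Matrix.trace_smul, smul_eq_mul, Complex.star_def, Complex.mul_conj,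
    Complex.re_ofReal_mul, Complex.normSq_eq_norm_sq]

theorem weight_eq_re_trace (Y : Matrix (Fin D) (Fin D) ℂ) :
    weight ρ Y = (Yᴴ * Y * ρ).trace.re := by
  rw [weight, Matrix.trace_mul_comm, mul_assoc]

/-- The mixed transfer matrix acting on `X` from the side of left eigenvectors. -/
def pull (A B : Tensor σ D) (X : Matrix (Fin D) (Fin D) ℂ) : Matrix (Fin D) (Fin D) ℂ :=
  ∑ s, (A s)ᴴ * X * B s

/-- Pythagoras: stacking over s, the tensor A is an isometry, so A·pull is the orthogonal projection
of Y·B onto its range. Stationarity of ρ under B gives the stack Y·B the same norm as Y. -/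
theorem sum_weight_sub (hA : IsLeftCanonical A) {B : Tensor σ D} (hB : transfer B ρ = ρ)
    (hρ : ρ.IsHermitian) (Y : Matrix (Fin D) (Fin D) ℂ) :
    ∑ s, weight ρ (Y * B s - A s * pull A B Y) = weight ρ Y - weight ρ (pull A B Y) := by
  set G := pull A B Y with hG
  have h1 : ∑ s, (Y * B s * ρ * (Y * B s)ᴴ).trace = (Y * ρ * Yᴴ).trace := by
    rw [← Matrix.trace_sum]
    conv_rhs => rw [← hB, transfer, Finset.mul_sum, Finset.sum_mul]
    simp only [Matrix.conjTranspose_mul, mul_assoc]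
  have h2 : ∑ s, (Y * B s * ρ * (A s * G)ᴴ).trace = (G * ρ * Gᴴ).trace := by
    conv_rhs => rw [hG, pull, Finset.sum_mul, Finset.sum_mul, Matrix.trace_sum, ← pull, ← hG]
    refine Finset.sum_congr rfl fun s _ => ?_
    rw [Matrix.conjTranspose_mul, ← mul_assoc, Matrix.trace_mul_comm]
    simp only [mul_assoc]
  have h3 : ∑ s, (A s * G * ρ * (Y * B s)ᴴ).trace = (G * ρ * Gᴴ).trace := by
    have := congrArg star h2
    rw [star_sum] at this
    simp only [← Matrix.trace_conjTranspose, Matrix.conjTranspose_mul,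
      Matrix.conjTranspose_conjTranspose, hρ.eq] at this
    simpa only [Matrix.conjTranspose_mul, mul_assoc] using this
  have h4 : ∑ s, (A s * G * ρ * (A s * G)ᴴ).trace = (G * ρ * Gᴴ).trace := by
    have h := hA.trace_transfer (G * ρ * Gᴴ)
    rw [transfer, Matrix.trace_sum] at h
    rw [← h]
    simp only [Matrix.conjTranspose_mul, mul_assoc]
  have h5 : ∑ s, ((Y * B s - A s * G) * ρ * (Y * B s - A s * G)ᴴ).trace
      = (Y * ρ * Yᴴ).trace - (G * ρ * Gᴴ).trace := by
    simp only [Matrix.conjTranspose_sub, sub_mul, mul_sub, Matrix.trace_sub,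
      Finset.sum_sub_distrib, h1, h2, h3, h4]
    ring
  have := congrArg Complex.re h5
  simpa [weight] using this

end Stationary

/-! ### Rigidity: eigenvalues outside the open disc give bond unitaries. -/

section Sequence

variable {σ : Type*} [Fintype σ] {D : ℕ} {A : Tensor σ D} {ρ : Matrix (Fin D) (Fin D) ℂ}

theorem weight_pull_le (hA : IsLeftCanonical A) {B : Tensor σ D} (hB : transfer B ρ = ρ)
    (hρ : ρ.PosDef) (Y : Matrix (Fin D) (Fin D) ℂ) : weight ρ (pull A B Y) ≤ weight ρ Y := by
  rw [← sub_nonneg, ← sum_weight_sub hA hB hρ.1]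
  exact Finset.sum_nonneg fun s _ => weight_nonneg hρ _

/-- The equality case of the contraction: every term of the nonnegative defect `sum_weight_sub`
vanishes. -/
theorem mul_eq_mul_pull (hA : IsLeftCanonical A) {B : Tensor σ D} (hB : transfer B ρ = ρ)
    (hρ : ρ.PosDef) {Y : Matrix (Fin D) (Fin D) ℂ} (hY : weight ρ (pull A B Y) = weight ρ Y)
    (s : σ) : Y * B s = A s * pull A B Y := by
  have h := sum_weight_sub hA hB hρ.1 Y
  rw [hY, sub_self, Finset.sum_eq_zero_iff_of_nonneg fun s _ => weight_nonneg hρ _] at h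
  exact sub_eq_zero.1 (weight_eq_zero hρ (h s (Finset.mem_univ s)))

theorem pull_smul (A B : Tensor σ D) (c : ℂ) (X : Matrix (Fin D) (Fin D) ℂ) :
    pull A B (c • X) = c • pull A B X := by
  simp only [pull, mul_smul_comm, smul_mul_assoc, Finset.smul_sum]

/-- The bond matrices obtained from `X` by moving along the chain. -/
def pullSeq (A : Tensor σ D) (B : ℕ → Tensor σ D) (X : Matrix (Fin D) (Fin D) ℂ) :
    ℕ → Matrix (Fin D) (Fin D) ℂ
  | 0 => X
  | j + 1 => pull A (B j) (pullSeq A B X j)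

theorem vec_vecMul_prod_mixedTransfer (A : Tensor σ D) (B : ℕ → Tensor σ D)
    (X : Matrix (Fin D) (Fin D) ℂ) (L : ℕ) :
    Xᵀ.vec ᵥ* (List.ofFn fun j : Fin L => mixedTransfer A (B j)).prod
      = (pullSeq A B X L)ᵀ.vec := by
  induction L with
  | zero => simp [pullSeq]
  | succ L ih =>
    rw [List.ofFn_succ', List.concat_eq_append, List.prod_append, List.prod_singleton,
      ← Matrix.vecMul_vecMul]
    simp only [Fin.val_castSucc, Fin.val_last]
    rw [ih, vec_vecMul_mixedTransfer]
    rfl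

/-- If the product of mixed transfer matrices over a period has an eigenvalue outside the open unit
disc, the two tensors are related by bond unitaries on every site. -/
theorem IsStationary.exists_unitary_seq (h : IsStationary A ρ) {B : ℕ → Tensor σ D}
    (hBρ : ∀ j, transfer (B j) ρ = ρ) (hBB : ∀ j Y, transferDual (B j) Y = transferDual A Y)
    {L : ℕ} (hL : 0 < L) (hper : ∀ j, ∃ c : Circle, ∀ s, B (j + L) s = (c : ℂ) • B j s)
    {μ : ℂ} (hμ : 1 ≤ ‖μ‖) {x : Fin D × Fin D → ℂ} (hx : x ≠ 0)
    (hxμ : x ᵥ* (List.ofFn fun j : Fin L => mixedTransfer A (B j)).prod = μ • x) :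
    ∃ X : ℕ → Matrix.unitaryGroup (Fin D) ℂ, ∀ j s,
      (X j : Matrix (Fin D) (Fin D) ℂ) * B j s = A s * (X (j + 1) : Matrix (Fin D) (Fin D) ℂ) := by
  obtain ⟨Y, rfl⟩ : ∃ Y : Matrix (Fin D) (Fin D) ℂ, Yᵀ.vec = x := by
    obtain ⟨Y, hY⟩ := Matrix.vec_bijective.2 x
    exact ⟨Yᵀ, by rw [Matrix.transpose_transpose, hY]⟩
  rw [vec_vecMul_prod_mixedTransfer, ← Matrix.vec_smul, Matrix.vec_inj, ← Matrix.transpose_smul,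
    Matrix.transpose_inj] at hxμ
  set Z := pullSeq A B Y with hZ
  have hZ0 : Z 0 = Y := rfl
  have hZs : ∀ j, Z (j + 1) = pull A (B j) (Z j) := fun j => rfl
  have hY0 : Y ≠ 0 := by
    rintro rfl
    simp at hx
  have hanti : Antitone fun j => weight ρ (Z j) :=
    antitone_nat_of_succ_le fun j => weight_pull_le h.leftCanonical (hBρ j) h.posDef _
  -- One period multiplies Z by a factor of modulus at least 1, while the weights cannot increase;
  -- hence they are constant along the chain.
  have hquasi : ∀ j, ∃ c : ℂ, 1 ≤ ‖c‖ ∧ Z (j + L) = c • Z j := by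
    intro j
    induction j with
    | zero => exact ⟨μ, hμ, by rw [zero_add]; exact hxμ⟩
    | succ j ih =>
      obtain ⟨c, hc, hcZ⟩ := ih
      obtain ⟨d, hd⟩ := hper j
      refine ⟨d * c, by rwa [norm_mul, Circle.norm_coe, one_mul], ?_⟩
      have hBd : B (j + L) = fun s => (d : ℂ) • B j s := funext hd
      rw [add_right_comm, hZs, hcZ, hBd, pull_smul, hZs, mul_comm, ← smul_smul]
      simp only [pull, mul_smul_comm, Finset.smul_sum]
  have hle : ∀ j, weight ρ (Z j) ≤ weight ρ (Z (j + L)) := fun j => by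
    obtain ⟨c, hc, hcZ⟩ := hquasi j
    rw [hcZ, weight_smul]
    exact le_mul_of_one_le_left (weight_nonneg h.posDef _) (one_le_pow₀ hc)
  have hsucc : ∀ j, weight ρ (Z (j + 1)) = weight ρ (Z j) := fun j =>
    le_antisymm (hanti (Nat.le_succ j)) ((hle j).trans (hanti (Nat.add_le_add_left hL j)))
  have hinter : ∀ j s, Z j * B j s = A s * Z (j + 1) := fun j s =>
    mul_eq_mul_pull h.leftCanonical (hBρ j) h.posDef (hsucc j) s
  have hconst : ∀ j, weight ρ (Z j) = weight ρ Y := fun j => by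
    induction j with
    | zero => rfl
    | succ j ih => rw [hsucc, ih]
  have hw0 : weight ρ Y ≠ 0 := fun h0 => hY0 (weight_eq_zero h.posDef h0)
  have hwpos : 0 < weight ρ Y := lt_of_le_of_ne (weight_nonneg h.posDef Y) hw0.symm
  -- The Gram matrices Z†Z follow the dual transfer map of A. They are L-periodic, and their
  -- iterates converge to a scalar matrix, so each is already scalar.
  have hQ : ∀ j, transferDual A ((Z j)ᴴ * Z j) = (Z (j + 1))ᴴ * Z (j + 1) := fun j => by
    have h1 : (Z (j + 1))ᴴ * Z (j + 1) = (Z (j + 1))ᴴ * transferDual A 1 * Z (j + 1) := by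
      rw [h.leftCanonical.transferDual_one, mul_one]
    rw [← hBB j, h1]
    simp only [transferDual, Finset.mul_sum, Finset.sum_mul]
    refine Finset.sum_congr rfl fun s _ => ?_
    have h2 : (B j s)ᴴ * ((Z j)ᴴ * Z j) * B j s = (Z j * B j s)ᴴ * (Z j * B j s) := by
      rw [Matrix.conjTranspose_mul]; simp only [mul_assoc]
    rw [h2, hinter, Matrix.conjTranspose_mul]
    simp only [mul_assoc, mul_one]
  have hiter : ∀ j k, (transferDual A)^[k] ((Z j)ᴴ * Z j) = (Z (j + k))ᴴ * Z (j + k) := by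
    intro j k
    induction k with
    | zero => rfl
    | succ k ih => rw [Function.iterate_succ_apply', ih, hQ, add_assoc]
  have hQper : ∀ j, (Z (j + L))ᴴ * Z (j + L) = (Z j)ᴴ * Z j := fun j => by
    obtain ⟨c, -, hcZ⟩ := hquasi j
    have hwc : weight ρ (Z (j + L)) = ‖c‖ ^ 2 * weight ρ (Z j) := by rw [hcZ, weight_smul]
    rw [hconst, hconst, eq_comm, mul_eq_right₀ hw0] at hwc
    rw [hcZ, Matrix.conjTranspose_smul, smul_mul_smul_comm, Complex.star_def, mul_comm,
      Complex.mul_conj, Complex.normSq_eq_norm_sq, hwc, Complex.ofReal_one, one_smul]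
  have hQper' : ∀ j m, (Z (j + m * L))ᴴ * Z (j + m * L) = (Z j)ᴴ * Z j := fun j m => by
    induction m with
    | zero => simp
    | succ m ih => rw [Nat.succ_mul, ← add_assoc, hQper, ih]
  have hscalar : ∀ j, (Z j)ᴴ * Z j = (weight ρ Y : ℂ) • 1 := fun j => by
    have hlim := (h.tendsto_iterate ((Z j)ᴴ * Z j)).comp
      (tendsto_id.atTop_mul_const' hL : Tendsto (fun m : ℕ => m * L) atTop atTop)
    simp only [Function.comp_def, hiter, hQper'] at hlim
    have heq := tendsto_nhds_unique tendsto_const_nhds hlim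
    rw [heq]
    congr 1
    have him : ((Z j)ᴴ * Z j * ρ).trace.im = 0 := by
      rw [mul_assoc, Matrix.trace_mul_comm]
      exact (Complex.nonneg_iff.1
        (h.posDef.posSemidef.mul_mul_conjTranspose_same (Z j)).trace_nonneg).2.symm
    refine Complex.ext ?_ him
    rw [← weight_eq_re_trace, hconst, Complex.ofReal_re]
  -- One constant normalises all bonds at once, since Z†Z is the same scalar everywhere.
  set t : ℝ := (Real.sqrt (weight ρ Y))⁻¹ with ht
  have htt : t * t * weight ρ Y = 1 := by
    rw [ht, ← mul_inv, Real.mul_self_sqrt hwpos.le, inv_mul_cancel₀ hw0]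
  refine ⟨fun j => ⟨(t : ℂ) • Z j, Matrix.mem_unitaryGroup_iff'.2 ?_⟩, fun j s => ?_⟩
  · rw [Matrix.star_eq_conjTranspose, Matrix.conjTranspose_smul, smul_mul_smul_comm, hscalar,
      smul_smul, Complex.star_def, Complex.conj_ofReal]
    rw [show ((t : ℂ) * t * (weight ρ Y : ℂ)) = 1 by exact_mod_cast htt, one_smul]
  · simp only [smul_mul_assoc, mul_smul_comm, hinter]

end Sequence

/-! ### Bond unitaries of a symmetric state. -/

section Symmetric

variable {σ : Type*} [Fintype σ] [DecidableEq σ] {D : ℕ} {A : Tensor σ D}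
  {ρ : Matrix (Fin D) (Fin D) ℂ}

/-- A left-canonical injective tensor generating eigenstates of the periodic extensions of
`⊗_{j<L} u_j` intertwines the operators `u_j` with bond unitaries. -/
theorem IsStationary.exists_bondUnitaries (h : IsStationary A ρ) {u : ℕ → Matrix σ σ ℂ}
    (hu : ∀ j, u j ∈ Matrix.unitaryGroup σ ℂ) {L : ℕ} (hL : 0 < L)
    (hper : ∀ j, EqPhase (u (j + L)) (u j))
    (hsym : ∀ m : ℕ, 0 < m → ∃ φ : Circle, ∀ s : Fin (m * L) → σ,
      chainOp (fun j : Fin (m * L) => u ((j : ℕ) % L)) (amplitude A (m * L)) s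
        = (φ : ℂ) * amplitude A (m * L) s) :
    ∃ X : ℕ → Matrix.unitaryGroup (Fin D) ℂ, ∀ j s,
      (X j : Matrix (Fin D) (Fin D) ℂ) * act (u j) A s
        = A s * (X (j + 1) : Matrix (Fin D) (Fin D) ℂ) := by
  set F := (List.ofFn fun j : Fin L => mixedTransfer A (act (u j) A)).prod with hF
  -- Both traces are overlaps, ⟨ψ|Uψ⟩ and ⟨ψ|ψ⟩, and the eigenvalue of U is a phase.
  have htrace : ∀ m : ℕ, 0 < m → ‖(F ^ m).trace‖ = ‖(mixedTransfer A A ^ (m * L)).trace‖ := by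
    intro m hm
    obtain ⟨φ, hφ⟩ := hsym m hm
    have h1 : (F ^ m).trace = ∑ s : Fin (m * L) → σ,
        starRingEnd ℂ (amplitude A (m * L) s) * ((φ : ℂ) * amplitude A (m * L) s) := by
      simp only [← hφ, chainOp_amplitude]
      rw [sum_conj_amplitude_mul A fun j : Fin (m * L) => act (u ((j : ℕ) % L)) A, hF,
        ← list_prod_ofFn_mod m L fun j => mixedTransfer A (act (u j) A)]
    have h2 : (mixedTransfer A A ^ (m * L)).trace = ∑ s : Fin (m * L) → σ,
        starRingEnd ℂ (amplitude A (m * L) s) * amplitude A (m * L) s := by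
      have := sum_conj_amplitude_mul A fun _ : Fin (m * L) => A
      rw [List.ofFn_const, List.prod_replicate] at this
      exact this.symm
    rw [h1, h2]
    simp only [mul_left_comm _ (φ : ℂ)]
    rw [← Finset.mul_sum, norm_mul, Circle.norm_coe, one_mul]
  have hnot : ¬ Tendsto (fun m : ℕ => (F ^ m).trace) atTop (𝓝 0) := by
    intro h0
    have h1 : Tendsto (fun m : ℕ => ‖(F ^ m).trace‖) atTop (𝓝 1) := by
      have h2 := ((h.tendsto_trace).comp
        (tendsto_id.atTop_mul_const' hL : Tendsto (fun m : ℕ => m * L) atTop atTop)).norm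
      rw [norm_one] at h2
      refine h2.congr' ?_
      filter_upwards [eventually_gt_atTop 0] with m hm
      exact (htrace m hm).symm
    have h2 := h0.norm
    rw [norm_zero] at h2
    exact zero_ne_one (tendsto_nhds_unique h2 h1)
  obtain ⟨μ, x, hx, hxμ, hμ⟩ := exists_vecMul_eigenvector F hnot
  refine h.exists_unitary_seq (B := fun j => act (u j) A)
    (fun j => (transfer_act (hu j) A ρ).trans h.fixed) (fun j Y => transferDual_act (hu j) A Y)
    hL (fun j => ?_) hμ hx hxμ
  obtain ⟨c, hc⟩ := hper j
  refine ⟨c, fun s => ?_⟩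
  simp only [act, hc, Matrix.smul_apply, smul_assoc, Finset.smul_sum]

end Symmetric

/-! ### Phases as central unitaries. -/

section Scalars

variable {m : Type*} [Fintype m] [DecidableEq m]

/-- A phase as a scalar unitary matrix. -/
def scalarUnitary (m : Type*) [Fintype m] [DecidableEq m] : Circle →* Matrix.unitaryGroup m ℂ where
  toFun c := ⟨(c : ℂ) • 1, by
    rw [Matrix.mem_unitaryGroup_iff, star_smul, star_one, smul_mul_smul_comm, one_mul,
      Complex.star_def, Complex.mul_conj, Circle.normSq_coe, Complex.ofReal_one, one_smul]⟩
  map_one' := Subtype.ext (by simp)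
  map_mul' c d := Subtype.ext (by simp [smul_smul, mul_comm])

theorem coe_scalarUnitary (c : Circle) :
    (scalarUnitary m c : Matrix m m ℂ) = (c : ℂ) • (1 : Matrix m m ℂ) := rfl

theorem coe_scalarUnitary_mul (c : Circle) (x : Matrix.unitaryGroup m ℂ) :
    ((scalarUnitary m c * x : Matrix.unitaryGroup m ℂ) : Matrix m m ℂ) = (c : ℂ) • (x : Matrix m m ℂ) := by
  rw [Matrix.UnitaryGroup.mul_val, coe_scalarUnitary, smul_mul_assoc, one_mul]

theorem scalarUnitary_commute (c : Circle) (x : Matrix.unitaryGroup m ℂ) :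
    Commute (scalarUnitary m c) x :=
  Subtype.ext (by simp [coe_scalarUnitary])

theorem scalarUnitary_injective [Nonempty m] : Function.Injective (scalarUnitary m) := by
  intro c d h
  have h1 := congrArg (fun x : Matrix.unitaryGroup m ℂ => (x : Matrix m m ℂ)) h
  obtain ⟨i⟩ := ‹Nonempty m›
  have h2 := congrFun (congrFun h1 i) i
  exact Circle.ext (by simpa [coe_scalarUnitary] using h2)

theorem eqPhase_iff {x y : Matrix.unitaryGroup m ℂ} :
    EqPhase (x : Matrix m m ℂ) (y : Matrix m m ℂ) ↔ ∃ c, x = scalarUnitary m c * y :=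
  exists_congr fun c => by
    rw [← coe_scalarUnitary_mul]
    exact ⟨fun h => Subtype.ext h, fun h => congrArg Subtype.val h⟩

theorem eq_scalarUnitary_mul_iff {x y : Matrix.unitaryGroup m ℂ} {c : Circle} :
    x = scalarUnitary m c * y ↔ (x : Matrix m m ℂ) = (c : ℂ) • (y : Matrix m m ℂ) := by
  rw [← coe_scalarUnitary_mul]
  exact ⟨fun h => congrArg Subtype.val h, fun h => Subtype.ext h⟩

theorem scalarUnitary_mul_zpow (c : Circle) (x : Matrix.unitaryGroup m ℂ) (k : ℤ) :
    (scalarUnitary m c * x) ^ k = scalarUnitary m (c ^ k) * x ^ k := by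
  rw [(scalarUnitary_commute c x).mul_zpow, map_zpow]

end Scalars

/-- A central commutator is bimultiplicative: conjugating by a power of one element multiplies the
other by a central factor, which then passes through powers. -/
theorem zpow_mul_zpow_of_commutator {G : Type*} [Group G] {x y z : G} (hz : ∀ g, Commute z g)
    (h : x * y = z * (y * x)) (k l : ℤ) : x ^ k * y ^ l = z ^ (k * l) * (y ^ l * x ^ k) := by
  have h1 : ∀ l : ℤ, x * y ^ l = z ^ l * (y ^ l * x) := fun l => by
    have h2 : x * y * x⁻¹ = z * y := by rw [h]; group
    have h3 : x * y ^ l * x⁻¹ = z ^ l * y ^ l := by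
      rw [← conj_zpow, h2, (hz y).mul_zpow]
    rw [← mul_assoc, ← h3]; group
  have h4 : (y ^ l)⁻¹ * x * y ^ l = z ^ l * x := by
    rw [mul_assoc, h1, ((hz (y ^ l)).zpow_left l).symm.inv_left.left_comm]
    group
  have h5 : (y ^ l)⁻¹ * x ^ k * y ^ l = z ^ (k * l) * x ^ k := by
    have := (conj_zpow (a := (y ^ l)⁻¹) (b := x) (i := k)).symm
    rw [inv_inv] at this
    rw [this, h4, ((hz x).zpow_left l).mul_zpow, ← zpow_mul, mul_comm k]
  rw [((hz (y ^ l)).zpow_left (k * l)).left_comm, ← h5]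
  group

/-! ### The group of push-through relations and uniqueness of bond unitaries. -/

section Push

variable {σ : Type*} [Fintype σ] {D : ℕ}

theorem act_mul (u w : Matrix σ σ ℂ) (A : Tensor σ D) : act (u * w) A = act u (act w A) := by
  funext s
  simp only [act, Matrix.mul_apply, Finset.sum_smul, Finset.smul_sum, smul_smul]
  exact Finset.sum_comm

theorem act_one [DecidableEq σ] (A : Tensor σ D) : act 1 A = A := by
  funext s
  simp [act, Matrix.one_apply]

theorem act_smul_left (c : ℂ) (u : Matrix σ σ ℂ) (A : Tensor σ D) (s : σ) :
    act (c • u) A s = c • act u A s := by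
  simp only [act, Matrix.smul_apply, smul_assoc, Finset.smul_sum]

theorem act_sandwich (u : Matrix σ σ ℂ) (A : Tensor σ D) (c : ℂ)
    (P Q : Matrix (Fin D) (Fin D) ℂ) (s : σ) :
    act u (fun t => c • (P * A t * Q)) s = c • (P * act u A s * Q) := by
  simp only [act, Finset.mul_sum, Finset.sum_mul, Finset.smul_sum, mul_smul_comm, smul_mul_assoc]
  exact Finset.sum_congr rfl fun t _ => smul_comm _ _ _

variable [DecidableEq σ]

/-- The quadruples `(φ, u, v, w)` with `u · A = φ v† A w`. -/
def pushGroup (A : Tensor σ D) :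
    Subgroup (Circle × Matrix.unitaryGroup σ ℂ × Matrix.unitaryGroup (Fin D) ℂ ×
      Matrix.unitaryGroup (Fin D) ℂ) where
  carrier := {p | ∀ s, act (p.2.1 : Matrix σ σ ℂ) A s
    = (p.1 : ℂ) • ((p.2.2.1 : Matrix (Fin D) (Fin D) ℂ)ᴴ * A s *
        (p.2.2.2 : Matrix (Fin D) (Fin D) ℂ))}
  one_mem' s := by simp [act_one]
  -- The operator of p acts inside the sandwich produced by q, giving v_q† v_p† = (v_p v_q)†, so
  -- products keep their order on all legs.
  mul_mem' {p q} hp hq s := by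
    simp only [Set.mem_ofPred_eq, Prod.fst_mul, Prod.snd_mul, Matrix.UnitaryGroup.mul_val,
      Circle.coe_mul] at *
    rw [act_mul, show act (q.2.1 : Matrix σ σ ℂ) A = _ from funext hq, act_sandwich, hp,
      Matrix.conjTranspose_mul, mul_smul_comm, smul_mul_assoc, smul_smul, mul_comm (q.1 : ℂ)]
    simp only [mul_assoc]
  inv_mem' {p} hp s := by
    obtain ⟨φ, u, v, w⟩ := p
    simp only [Set.mem_ofPred_eq, Prod.fst_inv, Prod.snd_inv] at *
    have h1 : A s = (φ : ℂ) • ((v : Matrix (Fin D) (Fin D) ℂ)ᴴ *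
        act ((u⁻¹ : Matrix.unitaryGroup σ ℂ) : Matrix σ σ ℂ) A s *
          (w : Matrix (Fin D) (Fin D) ℂ)) := by
      rw [← act_sandwich, ← show act (u : Matrix σ σ ℂ) A = _ from funext hp, ← act_mul,
        ← Matrix.UnitaryGroup.mul_val, inv_mul_cancel, Matrix.UnitaryGroup.one_val, act_one]
    have hv : (v : Matrix (Fin D) (Fin D) ℂ) * (v : Matrix (Fin D) (Fin D) ℂ)ᴴ = 1 :=
      Matrix.mem_unitaryGroup_iff.1 v.2
    have hw : (w : Matrix (Fin D) (Fin D) ℂ) * (w : Matrix (Fin D) (Fin D) ℂ)ᴴ = 1 :=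
      Matrix.mem_unitaryGroup_iff.1 w.2
    have hvi : ((v⁻¹ : Matrix.unitaryGroup (Fin D) ℂ) : Matrix (Fin D) (Fin D) ℂ)ᴴ = v :=
      Matrix.conjTranspose_conjTranspose _
    have hwi : ((w⁻¹ : Matrix.unitaryGroup (Fin D) ℂ) : Matrix (Fin D) (Fin D) ℂ)
        = (w : Matrix (Fin D) (Fin D) ℂ)ᴴ := rfl
    conv_rhs => rw [h1, hvi, hwi]
    rw [mul_smul_comm, smul_mul_assoc, smul_smul, Circle.coe_inv,
      inv_mul_cancel₀ (Circle.coe_ne_zero φ), one_smul, mul_assoc, mul_assoc, hw, mul_one,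
      ← mul_assoc, hv, one_mul]

theorem mem_pushGroup {A : Tensor σ D} {φ : Circle} {u : Matrix.unitaryGroup σ ℂ}
    {v w : Matrix.unitaryGroup (Fin D) ℂ} :
    (φ, u, v, w) ∈ pushGroup A ↔ ∀ s, act (u : Matrix σ σ ℂ) A s
      = (φ : ℂ) • ((v : Matrix (Fin D) (Fin D) ℂ)ᴴ * A s * (w : Matrix (Fin D) (Fin D) ℂ)) :=
  Iff.rfl

theorem pushesThrough_iff {r : ℕ} {a : Fin r → ℤ} {U : Fin r → Matrix.unitaryGroup σ ℂ}
    {A : Tensor σ D} {v : Fin r → Matrix.unitaryGroup (Fin D) ℂ} :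
    PushesThrough a U A v ↔ ∀ I (j : ℕ), ∃ φ : Circle,
      (φ, U I ^ (a I ^ j), v I ^ (a I ^ j), v I ^ (a I ^ (j + 1))) ∈ pushGroup A :=
  Iff.rfl

theorem scalar_mem_pushGroup (A : Tensor σ D) (c d e : Circle) :
    (c * d * e⁻¹, scalarUnitary σ c, scalarUnitary (Fin D) d, scalarUnitary (Fin D) e)
      ∈ pushGroup A := by
  rw [mem_pushGroup]
  intro s
  rw [coe_scalarUnitary, coe_scalarUnitary, coe_scalarUnitary, act_smul_left, act_one,
    Matrix.conjTranspose_smul, Matrix.conjTranspose_one, smul_mul_assoc, one_mul,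
    smul_mul_smul_comm, mul_one, smul_smul, Complex.star_def, ← Circle.coe_inv_eq_conj]
  congr 1
  simp only [← Circle.coe_mul]
  rw [← mul_assoc, mul_right_comm (c * d), mul_inv_cancel_right, inv_mul_cancel_right]

/-- Dividing by the evident scalar quadruple leaves a pure phase that fixes a nonzero tensor. -/
theorem phase_eq_of_scalar_mem {A : Tensor σ D} (hA : ∃ s, A s ≠ 0) {φ c d e : Circle}
    (h : (φ, scalarUnitary σ c, scalarUnitary (Fin D) d, scalarUnitary (Fin D) e) ∈ pushGroup A) :
    φ = c * d * e⁻¹ := by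
  have h1 := (pushGroup A).mul_mem h ((pushGroup A).inv_mem (scalar_mem_pushGroup A c d e))
  simp only [Prod.inv_mk, Prod.mk_mul_mk, mul_inv_cancel] at h1
  obtain ⟨s, hs⟩ := hA
  have h2 := mem_pushGroup.1 h1 s
  simp only [Matrix.UnitaryGroup.one_val, act_one, Matrix.conjTranspose_one, one_mul, mul_one] at h2
  have h3 : ((φ * (c * d * e⁻¹)⁻¹ : Circle) : ℂ) = 1 := by
    by_contra hne
    refine hs ((smul_eq_zero.1 (?_ : (1 - ((φ * (c * d * e⁻¹)⁻¹ : Circle) : ℂ)) • A s = 0)).resolve_left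
      (sub_ne_zero.2 (Ne.symm hne)))
    rw [sub_smul, one_smul, ← h2, sub_self]
  exact mul_inv_eq_one.1 (Circle.ext h3)

variable {A : Tensor σ D} {ρ : Matrix (Fin D) (Fin D) ℂ}

/-- A sequence of unitaries that commutes through the tensor up to phases is scalar. -/
theorem IsStationary.eq_scalar_of_mem (h : IsStationary A ρ)
    {W : ℕ → Matrix.unitaryGroup (Fin D) ℂ}
    (hW : ∀ j, ∃ φ c : Circle, (φ, scalarUnitary σ c, W j, W (j + 1)) ∈ pushGroup A) :
    ∃ d, W 0 = scalarUnitary (Fin D) d := by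
  -- Commuting `W j` past A turns ∑ A† W A into (∑ A†A) W, so the dual transfer map moves W to the
  -- next bond up to a phase.
  have hstep : ∀ j, ∃ c : Circle, transferDual A (W j : Matrix (Fin D) (Fin D) ℂ)
      = (c : ℂ) • (W (j + 1) : Matrix (Fin D) (Fin D) ℂ) := by
    intro j
    obtain ⟨φ, c, hφ⟩ := hW j
    have h1 := (pushGroup A).mul_mem ((pushGroup A).inv_mem (scalar_mem_pushGroup A c 1 1)) hφ
    simp only [Prod.inv_mk, Prod.mk_mul_mk, inv_mul_cancel, map_one, inv_one, one_mul,
      mul_one] at h1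
    rw [mem_pushGroup] at h1
    simp only [Matrix.UnitaryGroup.one_val, act_one] at h1
    refine ⟨c⁻¹ * φ, ?_⟩
    have h2 : ∀ s, (W j : Matrix (Fin D) (Fin D) ℂ) * A s
        = ((c⁻¹ * φ : Circle) : ℂ) • (A s * (W (j + 1) : Matrix (Fin D) (Fin D) ℂ)) := fun s => by
      have hv : (W j : Matrix (Fin D) (Fin D) ℂ) * (W j : Matrix (Fin D) (Fin D) ℂ)ᴴ = 1 :=
        Matrix.mem_unitaryGroup_iff.1 (W j).2
      conv_lhs => rw [h1 s]
      rw [mul_smul_comm, ← mul_assoc, ← mul_assoc, hv, one_mul]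
    have h3 : ∑ s, (A s)ᴴ * A s = 1 := h.leftCanonical
    simp only [transferDual, mul_assoc, h2, mul_smul_comm]
    simp only [← mul_assoc, ← Finset.smul_sum, ← Finset.sum_mul, h3, one_mul]
  have hiter : ∀ k : ℕ, ∃ c : Circle,
      (transferDual A)^[k] (W 0 : Matrix (Fin D) (Fin D) ℂ)
        = (c : ℂ) • (W k : Matrix (Fin D) (Fin D) ℂ) := by
    intro k
    induction k with
    | zero => exact ⟨1, by simp⟩
    | succ k ih =>
      obtain ⟨c, hc⟩ := ih
      obtain ⟨d, hd⟩ := hstep k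
      refine ⟨c * d, ?_⟩
      rw [Function.iterate_succ_apply', hc, Circle.coe_mul, ← smul_smul, ← hd]
      simp only [transferDual, mul_smul_comm, smul_mul_assoc, Finset.smul_sum]
  have hlim := h.tendsto_iterate (W 0 : Matrix (Fin D) (Fin D) ℂ)
  set t := ((W 0 : Matrix (Fin D) (Fin D) ℂ) * ρ).trace with ht
  have hunit : ∀ k : ℕ, ((transferDual A)^[k] (W 0 : Matrix (Fin D) (Fin D) ℂ))ᴴ *
      (transferDual A)^[k] (W 0 : Matrix (Fin D) (Fin D) ℂ) = 1 := fun k => by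
    obtain ⟨c, hc⟩ := hiter k
    rw [hc, ← coe_scalarUnitary_mul]
    exact Matrix.mem_unitaryGroup_iff'.1 (scalarUnitary (Fin D) c * W k).2
  have hlim2 : Tendsto (fun k : ℕ => ((transferDual A)^[k] (W 0 : Matrix (Fin D) (Fin D) ℂ))ᴴ *
      (transferDual A)^[k] (W 0 : Matrix (Fin D) (Fin D) ℂ)) atTop
      (𝓝 ((t • (1 : Matrix (Fin D) (Fin D) ℂ))ᴴ * t • (1 : Matrix (Fin D) (Fin D) ℂ))) :=
    ((continuous_id.matrix_conjTranspose.matrix_mul continuous_id).tendsto _).comp hlim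
  simp only [hunit] at hlim2
  have h1 := tendsto_nhds_unique tendsto_const_nhds hlim2
  -- The iterates are unitary and converge to t·1, so |t| = 1. This is equality in Cauchy–Schwarz
  -- between `W 0` and 1, which forces `W 0` = t·1.
  have htt : star t * t = 1 := by
    have h2 := congrArg (fun M => (M * ρ).trace) h1
    simp only [one_mul, Matrix.conjTranspose_smul, Matrix.conjTranspose_one,
      smul_mul_assoc, Matrix.trace_smul, h.trace_eq_one, smul_eq_mul, mul_one] at h2
    exact h2.symm
  have hWt : (W 0 : Matrix (Fin D) (Fin D) ℂ) - t • 1 = 0 := by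
    refine weight_eq_zero h.posDef ?_
    have hWW : (W 0 : Matrix (Fin D) (Fin D) ℂ)ᴴ * (W 0 : Matrix (Fin D) (Fin D) ℂ) = 1 :=
      Matrix.mem_unitaryGroup_iff'.1 (W 0).2
    have hst : ((W 0 : Matrix (Fin D) (Fin D) ℂ)ᴴ * ρ).trace = star t := by
      rw [ht, ← Matrix.trace_conjTranspose, Matrix.conjTranspose_mul, h.posDef.1.eq,
        Matrix.trace_mul_comm]
    rw [weight_eq_re_trace, Matrix.conjTranspose_sub, Matrix.conjTranspose_smul,
      Matrix.conjTranspose_one]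
    simp only [sub_mul, mul_sub, hWW, smul_mul_assoc, mul_smul_comm, one_mul, mul_one,
      Matrix.trace_sub, Matrix.trace_smul, smul_eq_mul, h.trace_eq_one, hst, ← ht, mul_comm t, htt]
    simp
  have hnorm : ‖t‖ = 1 := by
    have h2 := congrArg norm htt
    rw [norm_mul, norm_star, norm_one] at h2
    nlinarith [norm_nonneg t]
  obtain ⟨d, hd⟩ : ∃ d : Circle, (d : ℂ) = t := ⟨⟨t, mem_sphere_zero_iff_norm.2 hnorm⟩, rfl⟩
  refine ⟨d, Subtype.ext ?_⟩
  rw [coe_scalarUnitary, hd]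
  exact sub_eq_zero.1 hWt

/-- Bond unitaries are determined up to phases by the on-site operators up to phases. -/
theorem IsStationary.eq_scalar_mul (h : IsStationary A ρ) {u u' : ℕ → Matrix.unitaryGroup σ ℂ}
    {V V' : ℕ → Matrix.unitaryGroup (Fin D) ℂ}
    (hu : ∀ j, ∃ c, u j = scalarUnitary σ c * u' j)
    (hV : ∀ j, ∃ φ : Circle, (φ, u j, V j, V (j + 1)) ∈ pushGroup A)
    (hV' : ∀ j, ∃ φ : Circle, (φ, u' j, V' j, V' (j + 1)) ∈ pushGroup A) (i : ℕ) :
    ∃ d, V i = scalarUnitary (Fin D) d * V' i := by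
  obtain ⟨d, hd⟩ := h.eq_scalar_of_mem (W := fun j => V (i + j) * (V' (i + j))⁻¹) fun j => by
    obtain ⟨c, hc⟩ := hu (i + j)
    obtain ⟨φ, hφ⟩ := hV (i + j)
    obtain ⟨φ', hφ'⟩ := hV' (i + j)
    have h1 := (pushGroup A).mul_mem hφ ((pushGroup A).inv_mem hφ')
    simp only [Prod.inv_mk, Prod.mk_mul_mk, hc, mul_inv_cancel_right] at h1
    exact ⟨_, c, h1⟩
  exact ⟨d, by rw [← hd]; simp⟩

end Push

/-! ### Arithmetic of roots of unity. -/

section RootPhase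

theorem rootPhase_eq_one_iff {M : ℕ} (hM : 0 < M) (k : ℤ) : rootPhase M k = 1 ↔ (M : ℤ) ∣ k := by
  have hM' : (M : ℝ) ≠ 0 := by positivity
  have hpi : (2 * Real.pi : ℝ) ≠ 0 := by positivity
  rw [rootPhase, ← Circle.exp_zero, Circle.exp_eq_exp]
  refine exists_congr fun l => ?_
  rw [zero_add, div_eq_iff hM', mul_right_comm (l : ℝ), mul_comm (2 * Real.pi) (k : ℝ),
    mul_left_inj' hpi, mul_comm (M : ℤ)]
  exact_mod_cast Iff.rfl

theorem rootPhase_add (M : ℕ) (k l : ℤ) : rootPhase M (k + l) = rootPhase M k * rootPhase M l := by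
  rw [rootPhase, rootPhase, rootPhase, ← Circle.exp_add]
  congr 1
  push_cast
  ring

theorem rootPhase_neg (M : ℕ) (k : ℤ) : rootPhase M (-k) = (rootPhase M k)⁻¹ := by
  rw [rootPhase, rootPhase, ← Circle.exp_neg]
  congr 1
  push_cast
  ring

theorem rootPhase_zpow (M : ℕ) (k l : ℤ) : rootPhase M k ^ l = rootPhase M (k * l) := by
  rw [rootPhase, rootPhase, ← Circle.exp_zsmul]
  congr 1
  rw [zsmul_eq_mul]
  push_cast
  ring

theorem rootPhase_eq_iff {M : ℕ} (hM : 0 < M) (k l : ℤ) :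
    rootPhase M k = rootPhase M l ↔ k ≡ l [ZMOD M] := by
  rw [eq_comm, ← div_eq_one, div_eq_mul_inv, ← rootPhase_neg, ← rootPhase_add,
    rootPhase_eq_one_iff hM, Int.modEq_iff_dvd, sub_eq_add_neg]

theorem exists_rootPhase {M : ℕ} (hM : 0 < M) {c : Circle} (hc : c ^ M = 1) :
    ∃ k : ℤ, c = rootPhase M k := by
  have hM' : (M : ℝ) ≠ 0 := by positivity
  have h1 : Circle.exp (M * Complex.arg c) = Circle.exp 0 := by
    rw [Circle.exp_zero, ← hc, ← nsmul_eq_mul, Circle.exp_nsmul, Circle.exp_arg]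
  obtain ⟨k, hk⟩ := Circle.exp_eq_exp.1 h1
  refine ⟨k, ?_⟩
  have h2 : 2 * Real.pi * (k : ℝ) / (M : ℝ) = Complex.arg c := by
    rw [div_eq_iff hM']
    linarith
  rw [rootPhase, h2, Circle.exp_arg]

end RootPhase

/-! ### Ordered products of commuting families. -/

section OrderedProducts

theorem commute_list_prod_ofFn {M : Type*} [Monoid M] {n : ℕ} {x : M} {f : Fin n → M}
    (h : ∀ i, Commute x (f i)) : Commute x (List.ofFn f).prod := by
  refine Commute.list_prod_right _ _ fun y hy => ?_
  obtain ⟨i, rfl⟩ := (List.mem_ofFn' f y).1 hy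
  exact h i

theorem list_prod_ofFn_mul {M : Type*} [Monoid M] {n : ℕ} {f g : Fin n → M}
    (h : ∀ i j, Commute (f i) (g j)) :
    (List.ofFn f).prod * (List.ofFn g).prod = (List.ofFn fun i => f i * g i).prod := by
  induction n with
  | zero => simp
  | succ n ih =>
    rw [List.ofFn_succ, List.ofFn_succ (f := g), List.ofFn_succ (f := fun i => f i * g i),
      List.prod_cons, List.prod_cons, List.prod_cons, ← ih fun i j => h i.succ j.succ]
    have := commute_list_prod_ofFn (x := g 0) (f := fun i : Fin n => f i.succ)
      fun i => (h i.succ 0).symm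
    rw [mul_assoc, mul_assoc, this.symm.left_comm]

theorem list_prod_ofFn_single {M : Type*} [Monoid M] {n : ℕ} (i : Fin n) {f : Fin n → M}
    (h : ∀ j, j ≠ i → f j = 1) : (List.ofFn f).prod = f i := by
  induction n with
  | zero => exact i.elim0
  | succ n ih =>
    rw [List.ofFn_succ, List.prod_cons]
    refine Fin.cases (fun h => ?_) (fun i h => ?_) i h
    · rw [List.prod_eq_one, mul_one]
      intro y hy
      obtain ⟨j, rfl⟩ := (List.mem_ofFn' _ y).1 hy
      exact h _ (Fin.succ_ne_zero j)
    · rw [h 0 (Fin.succ_ne_zero i).symm, one_mul,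
        ih i fun j hj => h j.succ fun e => hj (Fin.succ_injective _ e)]

end OrderedProducts

/-! ### Projective representations on bonds and their commutator invariant. -/

section Projective

variable {D r : ℕ}

/-- The subgroup of scalar unitaries. -/
noncomputable abbrev scalarSubgroup (D : ℕ) : Subgroup (Matrix.unitaryGroup (Fin D) ℂ) :=
  (scalarUnitary (Fin D)).range

instance scalarSubgroup_normal (D : ℕ) : (scalarSubgroup D).Normal where
  conj_mem := by
    rintro _ ⟨c, rfl⟩ g
    refine ⟨c, ?_⟩
    rw [← (scalarUnitary_commute c g).eq, mul_inv_cancel_right]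

theorem mk_eq_mk_iff_exists_scalar {x y : Matrix.unitaryGroup (Fin D) ℂ} :
    (x : Matrix.unitaryGroup (Fin D) ℂ ⧸ scalarSubgroup D) = y ↔
      ∃ c, x = scalarUnitary (Fin D) c * y := by
  rw [eq_comm, QuotientGroup.eq]
  refine exists_congr fun c => ?_
  rw [eq_inv_mul_iff_mul_eq, (scalarUnitary_commute c y).eq, eq_comm]

theorem zpow_eq_zpow_of_modEq {G : Type*} [Group G] {x : G} {N : ℕ} (hx : x ^ N = 1) {k l : ℤ}
    (h : k ≡ l [ZMOD N]) : x ^ k = x ^ l := by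
  obtain ⟨m, hm⟩ := h.dvd
  rw [eq_add_of_sub_eq' hm, zpow_add, zpow_mul, zpow_natCast, hx, one_zpow, mul_one]

/-- Bond unitaries of finite order that commute, both up to phases, define a projective
representation. -/
theorem exists_hasCocycle {N : Fin r → ℕ} (hN : ∀ I, 0 < N I) (a : Fin r → ℤ)
    {v : Fin r → Matrix.unitaryGroup (Fin D) ℂ}
    (hpow : ∀ I, ∃ c, v I ^ N I = scalarUnitary (Fin D) c)
    (hcomm : ∀ I J, ∃ c, v I * v J = scalarUnitary (Fin D) c * (v J * v I)) (j : ℕ) :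
    ∃ ω, HasCocycle (bondOp N a v j) ω := by
  -- Modulo scalars the generators commute and their orders divide `N I`, so the ordered product
  -- becomes an honest homomorphism; lifting back produces ω.
  let q := QuotientGroup.mk' (scalarSubgroup D)
  have hq : ∀ g, q (bondOp N a v j g)
      = (List.ofFn fun I => q (v I) ^ (a I ^ j * ((g I).val : ℤ))).prod := fun g => by
    rw [bondOp, map_list_prod, List.map_ofFn]
    simp only [Function.comp_def, map_zpow]
  have hqpow : ∀ I, q (v I) ^ N I = 1 := fun I => by
    obtain ⟨c, hc⟩ := hpow I
    rw [← map_pow, ← map_one q]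
    exact mk_eq_mk_iff_exists_scalar.2 ⟨c, by rw [hc, mul_one]⟩
  have hqcomm : ∀ I J, Commute (q (v I)) (q (v J)) := fun I J => by
    obtain ⟨c, hc⟩ := hcomm I J
    rw [Commute, SemiconjBy, ← map_mul, ← map_mul]
    exact mk_eq_mk_iff_exists_scalar.2 ⟨c, hc⟩
  have hmul : ∀ g h, ∃ c, bondOp N a v j g * bondOp N a v j h
      = scalarUnitary (Fin D) c * bondOp N a v j (g + h) := fun g h => by
    rw [← mk_eq_mk_iff_exists_scalar]
    change q _ = q _
    rw [map_mul, hq, hq, hq, list_prod_ofFn_mul fun I J => (hqcomm I J).zpow_zpow _ _]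
    congr 2
    funext I
    have : NeZero (N I) := ⟨(hN I).ne'⟩
    rw [← zpow_add, ← mul_add]
    refine zpow_eq_zpow_of_modEq (hqpow I) (Int.ModEq.mul_left _ ?_)
    rw [Pi.add_apply, ZMod.val_add]
    push_cast
    exact (Int.mod_modEq _ _).symm
  choose ω hω using hmul
  refine ⟨ω, fun g h => ?_⟩
  have := congrArg Subtype.val (hω g h)
  rw [coe_scalarUnitary_mul] at this
  exact this

theorem bondOp_single {N : Fin r → ℕ} (a : Fin r → ℤ)
    (v : Fin r → Matrix.unitaryGroup (Fin D) ℂ) (j : ℕ) (I : Fin r) :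
    bondOp N a v j (Pi.single I 1) = v I ^ (a I ^ j * ((1 : ZMod (N I)).val : ℤ)) := by
  rw [bondOp, list_prod_ofFn_single I fun J hJ => by simp [hJ]]
  simp

/-- The commutator phase of two bond unitaries is their bond class. -/
theorem isBondClass_of_commutator {N : Fin r → ℕ} (hN : ∀ I, 0 < N I) (a : Fin r → ℤ)
    {v : Fin r → Matrix.unitaryGroup (Fin D) ℂ} [Nonempty (Fin D)] {I J : Fin r} {k : ℤ}
    (hk : v I * v J
      = scalarUnitary (Fin D) (rootPhase (Nat.gcd (N I) (N J)) k) * (v J * v I)) :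
    IsBondClass N a v I J (Nat.gcd (N I) (N J)) k := by
  set M := Nat.gcd (N I) (N J) with hM
  have hM0 : 0 < M := Nat.gcd_pos_of_pos_left _ (hN I)
  have hzp : ∀ x y : ℤ, v I ^ x * v J ^ y
      = scalarUnitary (Fin D) (rootPhase M (k * (x * y))) * (v J ^ y * v I ^ x) := fun x y => by
    rw [zpow_mul_zpow_of_commutator (scalarUnitary_commute _) hk, ← map_zpow, rootPhase_zpow]
  intro j
  refine ⟨?_, fun ω hω => ?_⟩
  · have h1 := hzp (a I ^ j) (a J ^ j)
    rw [← mul_pow, eq_scalarUnitary_mul_iff] at h1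
    exact h1
  · have h1 := hω (Pi.single I 1) (Pi.single J 1)
    have h2 := hω (Pi.single J 1) (Pi.single I 1)
    rw [← Matrix.UnitaryGroup.mul_val, ← eq_scalarUnitary_mul_iff] at h1 h2
    rw [add_comm] at h2
    -- Both orders of multiplication land on the same S because the group is abelian; cancelling S
    -- isolates the ratio of cocycle values.
    set S := bondOp N a v j (Pi.single I 1 + Pi.single J 1)
    have h3 : scalarUnitary (Fin D) (ω (Pi.single I 1) (Pi.single J 1)) =
        scalarUnitary (Fin D) (rootPhase M
          (k * ((a I ^ j * ((1 : ZMod (N I)).val : ℤ)) * (a J ^ j * ((1 : ZMod (N J)).val : ℤ))))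
          * ω (Pi.single J 1) (Pi.single I 1)) := by
      rw [← mul_left_inj S, ← h1, map_mul, mul_assoc, ← h2, bondOp_single, bondOp_single, hzp]
    rw [scalarUnitary_injective h3, mul_inv_cancel_right, rootPhase_eq_iff hM0]
    -- In `ZMod 1` the value of 1 is 0, so the bond operator of that generator is trivial; the
    -- modulus is then 1 and the claim is empty.
    by_cases h : N I = 1 ∨ N J = 1
    · have hM1 : M = 1 := by
        rcases h with h | h <;> simp [hM, h]
      rw [hM1]
      exact Int.modEq_one
    · rw [not_or] at h
      have hone : ∀ K, N K ≠ 1 → (1 : ZMod (N K)).val = 1 := fun K hK => by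
        rw [ZMod.val_one_eq_one_mod]
        exact Nat.mod_eq_of_lt (lt_of_le_of_ne (hN K) (Ne.symm hK))
      rw [hone I h.1, hone J h.2, mul_pow]
      simp [Int.ModEq.refl]

end Projective

theorem mul_mul_mul_eq_of_commute {G : Type*} [Group G] {s t z x y : G} (hs : ∀ g, Commute s g)
    (ht : ∀ g, Commute t g) (hz : ∀ g, Commute z g) (h : x * y = z * (y * x)) :
    (s * x) * (t * y) = z * ((t * y) * (s * x)) := by
  rw [(ht x).symm.mul_mul_mul_comm, (hs y).symm.mul_mul_mul_comm, h, (hs t).eq,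
    (hz (t * s)).left_comm]

/-! ### Bond unitaries of exponential symmetries and the bond equation. -/

section Class

variable {σ : Type*} [Fintype σ] [DecidableEq σ] {D r : ℕ} {A : Tensor σ D}
  {ρ : Matrix (Fin D) (Fin D) ℂ} {a : Fin r → ℤ} {U : Fin r → Matrix.unitaryGroup σ ℂ}

/-- The a-th power of the relation at bond j has the same on-site operators as the relation shifted
by one site. Uniqueness makes the bond unitary at j+1 the a-th power of that at j up to a phase, so
the one at bond 0 generates all of them. -/
theorem IsStationary.exists_pushesThrough (h : IsStationary A ρ) {L : ℕ} (hL : 0 < L)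
    (hper : ∀ I, IsPeriodic L (U I) (a I)) (hsym : IsSymmetric L a U A) :
    ∃ v : Fin r → Matrix.unitaryGroup (Fin D) ℂ, PushesThrough a U A v := by
  suffices H : ∀ I, ∃ v : Matrix.unitaryGroup (Fin D) ℂ, ∀ j : ℕ, ∃ φ : Circle,
      (φ, U I ^ (a I ^ j), v ^ (a I ^ j), v ^ (a I ^ (j + 1))) ∈ pushGroup A by
    choose v hv using H
    exact ⟨v, pushesThrough_iff.2 hv⟩
  intro I
  obtain ⟨c, hc⟩ := eqPhase_iff.1 (hper I)
  obtain ⟨X, hX⟩ := h.exists_bondUnitaries (u := fun j => siteOp (U I) (a I) j)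
    (fun j => (U I ^ (a I ^ j)).2) hL (fun j => eqPhase_iff.2 ⟨c ^ (a I ^ j), by
      rw [pow_add, mul_comm, zpow_mul, hc, scalarUnitary_mul_zpow]⟩) (hsym I)
  have hmem : ∀ j, ((1 : Circle), U I ^ (a I ^ j), X j, X (j + 1)) ∈ pushGroup A := fun j => by
    rw [mem_pushGroup]
    intro s
    have hXj : (X j : Matrix (Fin D) (Fin D) ℂ)ᴴ * (X j : Matrix (Fin D) (Fin D) ℂ) = 1 :=
      Matrix.mem_unitaryGroup_iff'.1 (X j).2
    rw [mul_assoc, ← hX, ← mul_assoc, hXj, one_mul, Circle.coe_one, one_smul]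
    rfl
  have hstep : ∀ j, ∃ d, X (j + 1) = scalarUnitary (Fin D) d * X j ^ a I :=
    h.eq_scalar_mul (u := fun j => U I ^ (a I ^ (j + 1))) (u' := fun j => U I ^ (a I ^ (j + 1)))
      (V := fun j => X (j + 1)) (V' := fun j => X j ^ a I) (fun j => ⟨1, by simp⟩)
      (fun j => ⟨1, hmem (j + 1)⟩) (fun j => ⟨1, by
        have := (pushGroup A).zpow_mem (hmem j) (a I)
        simp only [Prod.pow_mk, one_zpow, ← zpow_mul, ← pow_succ] at this
        exact this⟩)
  have hXv : ∀ j, ∃ d, X j = scalarUnitary (Fin D) d * X 0 ^ (a I ^ j) := fun j => by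
    induction j with
    | zero => exact ⟨1, by simp⟩
    | succ j ih =>
      obtain ⟨d, hd⟩ := ih
      obtain ⟨e, he⟩ := hstep j
      exact ⟨e * d ^ a I, by
        rw [he, hd, scalarUnitary_mul_zpow, map_mul, mul_assoc, ← zpow_mul, ← pow_succ]⟩
  refine ⟨X 0, fun j => ?_⟩
  obtain ⟨d, hd⟩ := hXv j
  obtain ⟨e, he⟩ := hXv (j + 1)
  have h1 := (pushGroup A).mul_mem ((pushGroup A).inv_mem (scalar_mem_pushGroup A 1 d e)) (hmem j)
  simp only [Prod.inv_mk, Prod.mk_mul_mk, hd, he, inv_mul_cancel_left, map_one, inv_one,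
    one_mul] at h1
  exact ⟨_, h1⟩

variable {v : Fin r → Matrix.unitaryGroup (Fin D) ℂ}

theorem IsStationary.bond_pow_eq_scalar (h : IsStationary A ρ) (hv : PushesThrough a U A v)
    {I : Fin r} {N : ℕ} (hU : ∃ c, U I ^ N = scalarUnitary σ c) :
    ∃ c, v I ^ N = scalarUnitary (Fin D) c := by
  obtain ⟨c, hc⟩ := hU
  obtain ⟨d, hd⟩ := h.eq_scalar_mul (u := fun j => (U I ^ (a I ^ j)) ^ N) (u' := fun _ => 1)
    (V := fun j => (v I ^ (a I ^ j)) ^ N) (V' := fun _ => 1)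
    (fun j => ⟨c ^ (a I ^ j), by
      rw [mul_one, ← zpow_natCast, zpow_comm, zpow_natCast, hc, map_zpow]⟩)
    (fun j => by
      obtain ⟨φ, hφ⟩ := pushesThrough_iff.1 hv I j
      exact ⟨_, (pushGroup A).pow_mem hφ N⟩)
    (fun j => ⟨1, (pushGroup A).one_mem⟩) 0
  exact ⟨d, by simpa using hd⟩

/-- The two orders of multiplication belong to on-site operators that agree up to a phase, so
uniqueness applies to the bonds. -/
theorem IsStationary.bond_commutator_scalar (h : IsStationary A ρ) (hv : PushesThrough a U A v)
    {I J : Fin r} (hU : ∃ c, U I * U J = scalarUnitary σ c * (U J * U I)) :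
    ∃ c, v I * v J = scalarUnitary (Fin D) c * (v J * v I) := by
  obtain ⟨c, hc⟩ := hU
  obtain ⟨d, hd⟩ := h.eq_scalar_mul (u := fun j => U I ^ (a I ^ j) * U J ^ (a J ^ j))
    (u' := fun j => U J ^ (a J ^ j) * U I ^ (a I ^ j))
    (V := fun j => v I ^ (a I ^ j) * v J ^ (a J ^ j))
    (V' := fun j => v J ^ (a J ^ j) * v I ^ (a I ^ j))
    (fun j => ⟨c ^ (a I ^ j * a J ^ j), by
      rw [map_zpow]
      exact zpow_mul_zpow_of_commutator (scalarUnitary_commute c) hc _ _⟩)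
    (fun j => by
      obtain ⟨φ, hφ⟩ := pushesThrough_iff.1 hv I j
      obtain ⟨ψ, hψ⟩ := pushesThrough_iff.1 hv J j
      have h1 := (pushGroup A).mul_mem hφ hψ
      rw [Prod.mk_mul_mk, Prod.mk_mul_mk, Prod.mk_mul_mk] at h1
      exact ⟨_, h1⟩)
    (fun j => by
      obtain ⟨φ, hφ⟩ := pushesThrough_iff.1 hv I j
      obtain ⟨ψ, hψ⟩ := pushesThrough_iff.1 hv J j
      have h1 := (pushGroup A).mul_mem hψ hφ
      rw [Prod.mk_mul_mk, Prod.mk_mul_mk, Prod.mk_mul_mk] at h1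
      exact ⟨_, h1⟩) 0
  exact ⟨d, by simpa using hd⟩

theorem IsStationary.eq_scalar_mul_of_pushesThrough (h : IsStationary A ρ)
    (hv : PushesThrough a U A v) {v' : Fin r → Matrix.unitaryGroup (Fin D) ℂ}
    (hv' : PushesThrough a U A v') (I : Fin r) : ∃ c, v I = scalarUnitary (Fin D) c * v' I := by
  obtain ⟨d, hd⟩ := h.eq_scalar_mul (u := fun j => U I ^ (a I ^ j)) (u' := fun j => U I ^ (a I ^ j))
    (fun j => ⟨1, by simp⟩) (pushesThrough_iff.1 hv I) (pushesThrough_iff.1 hv' I) 0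
  exact ⟨d, by simpa using hd⟩

/-- The commutator phases of the on-site and of the bond unitaries. -/
theorem IsStationary.commutator_phase (h : IsStationary A ρ) (hv : PushesThrough a U A v)
    {I J : Fin r} {c d : Circle} (hU : U I * U J = scalarUnitary σ c * (U J * U I))
    (hc : v I * v J = scalarUnitary (Fin D) d * (v J * v I)) : d ^ (a I * a J - 1) = c := by
  obtain ⟨φ, hφ⟩ := pushesThrough_iff.1 hv I 0
  obtain ⟨ψ, hψ⟩ := pushesThrough_iff.1 hv J 0
  -- In the commutator at the first site the unknown phases φ, ψ cancel. The left bond contributes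
  -- d, and the right bond, carrying the powers `a I` and `a J`, contributes d^(a_I a_J).
  have h1 := (pushGroup A).mul_mem ((pushGroup A).mul_mem hφ hψ)
    ((pushGroup A).inv_mem ((pushGroup A).mul_mem hψ hφ))
  have hc' := zpow_mul_zpow_of_commutator (scalarUnitary_commute d) hc (a I) (a J)
  simp only [Prod.inv_mk, Prod.mk_mul_mk, pow_zero, zpow_one, zero_add, pow_one, hU, hc, hc',
    mul_inv_cancel_right, ← map_zpow] at h1
  have h2 := phase_eq_of_scalar_mem h.exists_ne_zero h1
  rw [mul_comm φ ψ, mul_inv_cancel, eq_mul_inv_iff_mul_eq, one_mul] at h2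
  rw [zpow_sub, h2, zpow_one, mul_inv_cancel_right]

/-- The bond class of a pair of generators. -/
theorem IsStationary.exists_bondClass (h : IsStationary A ρ) {N : Fin r → ℕ} (hN : ∀ I, 0 < N I)
    {I J : Fin r} {n : ℤ} (hI : ∃ c, U I ^ N I = scalarUnitary σ c)
    (hJ : ∃ c, U J ^ N J = scalarUnitary σ c)
    (hU : U I * U J = scalarUnitary σ (rootPhase (Nat.gcd (N I) (N J)) n) * (U J * U I))
    (hv : PushesThrough a U A v) :
    ∃ k : ℤ, SolvesBondEquation (Nat.gcd (N I) (N J)) (a I * a J) n k ∧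
      ∀ v : Fin r → Matrix.unitaryGroup (Fin D) ℂ, PushesThrough a U A v →
        IsBondClass N a v I J (Nat.gcd (N I) (N J)) k := by
  have := h.nonempty
  obtain ⟨d, hd⟩ := h.bond_commutator_scalar hv ⟨_, hU⟩
  -- The power v_I^(N_I) is scalar, hence commutes with v_J; the same for J makes d a root of unity
  -- of order dividing the gcd.
  have hdI : d ^ N I = 1 := by
    obtain ⟨c, hc⟩ := h.bond_pow_eq_scalar hv hI
    have h1 := zpow_mul_zpow_of_commutator (scalarUnitary_commute d) hd (N I) 1
    rw [zpow_natCast, hc, zpow_one, mul_one, zpow_natCast, (scalarUnitary_commute c _).eq,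
      right_eq_mul, ← map_pow, ← map_one (scalarUnitary (Fin D))] at h1
    exact scalarUnitary_injective h1
  have hdJ : d ^ N J = 1 := by
    obtain ⟨c, hc⟩ := h.bond_pow_eq_scalar hv hJ
    have h1 := zpow_mul_zpow_of_commutator (scalarUnitary_commute d) hd 1 (N J)
    rw [zpow_natCast, hc, zpow_one, one_mul, zpow_natCast, (scalarUnitary_commute c _).eq,
      right_eq_mul, ← map_pow, ← map_one (scalarUnitary (Fin D))] at h1
    exact scalarUnitary_injective h1
  have hM0 : 0 < Nat.gcd (N I) (N J) := Nat.gcd_pos_of_pos_left _ (hN I)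
  obtain ⟨k, rfl⟩ := exists_rootPhase hM0 (pow_gcd_eq_one.2 ⟨hdI, hdJ⟩)
  refine ⟨k, ?_, fun v' hv' => isBondClass_of_commutator hN a ?_⟩
  · have h1 := h.commutator_phase hv hU hd
    rwa [rootPhase_zpow, rootPhase_eq_iff hM0] at h1
  -- Another choice of bond unitaries differs by phases, which drop out of the commutator, so k does
  -- not change.
  · obtain ⟨x, hx⟩ := h.eq_scalar_mul_of_pushesThrough hv' hv I
    obtain ⟨y, hy⟩ := h.eq_scalar_mul_of_pushesThrough hv' hv J
    rw [hx, hy]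
    exact mul_mul_mul_eq_of_commute (scalarUnitary_commute x) (scalarUnitary_commute y)
      (scalarUnitary_commute _) hd

end Class

/-! ### The linear congruence for the bond class. -/

section BondEquation

variable {M : ℕ} {q n : ℤ}

theorem gcd_sub_one_pos (hM : 0 < M) (q : ℤ) : 0 < Int.gcd (q - 1) M :=
  Int.gcd_pos_of_ne_zero_right _ (by exact_mod_cast hM.ne')

theorem exists_solvesBondEquation_iff :
    (∃ k : ℤ, SolvesBondEquation M q n k) ↔ (Int.gcd (q - 1) M : ℤ) ∣ n := by
  constructor
  · rintro ⟨k, hk⟩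
    obtain ⟨t, ht⟩ := hk.dvd
    rw [sub_eq_iff_eq_add] at ht
    rw [ht]
    exact dvd_add (Dvd.dvd.mul_right (Int.gcd_dvd_right _ _) _) (Dvd.dvd.mul_left (Int.gcd_dvd_left _ _) _)
  · rintro ⟨t, rfl⟩
    refine ⟨Int.gcdA (q - 1) M * t, ?_⟩
    have h := Int.gcd_eq_gcd_ab (q - 1) M
    refine Int.modEq_iff_dvd.2 ⟨Int.gcdB (q - 1) M * t, ?_⟩
    linear_combination t * h

/-- Bézout's identity for the gcd, divided by the gcd; the inverse is the Bézout coefficient of q -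
1. -/
theorem exists_inverse_mod (hM : 0 < M) (q : ℤ) :
    ∃ u : ℤ, u * ((q - 1) / (Int.gcd (q - 1) M : ℤ)) ≡ 1
      [ZMOD (M : ℤ) / (Int.gcd (q - 1) M : ℤ)] := by
  set g := Int.gcd (q - 1) M with hg
  have hg0 : (g : ℤ) ≠ 0 := by exact_mod_cast (gcd_sub_one_pos hM q).ne'
  obtain ⟨p, hp⟩ : (g : ℤ) ∣ q - 1 := Int.gcd_dvd_left _ _
  obtain ⟨m, hm⟩ : (g : ℤ) ∣ M := Int.gcd_dvd_right _ _
  have h := Int.gcd_eq_gcd_ab (q - 1) M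
  rw [← hg] at h
  rw [hp, hm, Int.mul_ediv_cancel_left _ hg0, Int.mul_ediv_cancel_left _ hg0]
  refine ⟨Int.gcdA (q - 1) M, Int.modEq_iff_dvd.2 ⟨Int.gcdB (q - 1) M, ?_⟩⟩
  refine mul_left_cancel₀ hg0 ?_
  linear_combination h + Int.gcdA (q - 1) M * hp + Int.gcdB (q - 1) M * hm

theorem solvesBondEquation_iff_existsUnique (hM : 0 < M) (hn : (Int.gcd (q - 1) M : ℤ) ∣ n) {u : ℤ}
    (hu : u * ((q - 1) / (Int.gcd (q - 1) M : ℤ)) ≡ 1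
      [ZMOD (M : ℤ) / (Int.gcd (q - 1) M : ℤ)]) (k : ℤ) :
    SolvesBondEquation M q n k ↔ ∃! τ : ℕ, τ < Int.gcd (q - 1) M ∧
      k ≡ n / (Int.gcd (q - 1) M : ℤ) * u + τ * ((M : ℤ) / (Int.gcd (q - 1) M : ℤ))
        [ZMOD (M : ℤ)] := by
  set g := Int.gcd (q - 1) M with hg
  have hgpos : (0 : ℤ) < g := by exact_mod_cast gcd_sub_one_pos hM q
  have hg0 : (g : ℤ) ≠ 0 := hgpos.ne'
  obtain ⟨p, hp⟩ : (g : ℤ) ∣ q - 1 := Int.gcd_dvd_left _ _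
  obtain ⟨m, hm⟩ : (g : ℤ) ∣ M := Int.gcd_dvd_right _ _
  obtain ⟨n', rfl⟩ := hn
  have hm0 : m ≠ 0 := by
    rintro rfl
    rw [mul_zero] at hm
    exact hM.ne' (by exact_mod_cast hm)
  rw [hp, hm, Int.mul_ediv_cancel_left _ hg0, Int.mul_ediv_cancel_left _ hg0] at hu
  rw [SolvesBondEquation, hp, hm, Int.mul_ediv_cancel_left _ hg0, Int.mul_ediv_cancel_left _ hg0]
  obtain ⟨x, hx⟩ := hu.dvd
  constructor
  · intro hk
    obtain ⟨y, hy⟩ := hk.dvd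
    have hy' : n' - k * p = m * y := mul_left_cancel₀ hg0 (by linear_combination hy)
    -- With q - 1 = g p and M = g m, substitute 1 = u p + m x into k·1 and use k p = n' - m y. The
    -- coefficient of m matters only modulo g, so τ is its residue.
    have hks : k = n' * u + (k * x - u * y) * m := by linear_combination k * hx - u * hy'
    set s := k * x - u * y
    have hmod : (((s % g).toNat : ℕ) : ℤ) = s % g :=
      Int.toNat_of_nonneg (Int.emod_nonneg _ hg0)
    refine ⟨(s % g).toNat, ⟨?_, ?_⟩, ?_⟩
    · exact_mod_cast hmod.trans_lt (Int.emod_lt_of_pos s hgpos)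
    · rw [hmod]
      refine Int.modEq_iff_dvd.2 ⟨-(s / g), ?_⟩
      linear_combination -hks + m * Int.emod_add_mul_ediv s g
    · rintro τ ⟨hτ, hkτ⟩
      obtain ⟨z, hz⟩ := hkτ.dvd
      have hτs : (τ : ℤ) = s + g * z := mul_right_cancel₀ hm0 (by linear_combination hz + hks)
      have : s % g = τ := by
        rw [eq_sub_of_add_eq hτs.symm, sub_eq_add_neg, ← mul_neg, Int.add_mul_emod_self_left]
        exact Int.emod_eq_of_lt (Int.natCast_nonneg τ) (by exact_mod_cast hτ)
      rw [this, Int.toNat_natCast]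
  · rintro ⟨τ, ⟨-, hkτ⟩, -⟩
    obtain ⟨z, hz⟩ := hkτ.dvd
    refine Int.modEq_iff_dvd.2 ⟨n' * x - τ * p + g * z * p, ?_⟩
    linear_combination g * n' * hx + g * p * hz

/-- If M divides k, the left side of the congruence vanishes modulo M and so does n; if M divides n,
then k = 0 is a solution. -/
theorem forall_solution_not_dvd_iff :
    (∀ k : ℤ, SolvesBondEquation M q n k → ¬ (M : ℤ) ∣ k) ↔ ¬ (M : ℤ) ∣ n := by
  constructor
  · intro h hn
    refine h 0 ?_ (dvd_zero _)
    rw [SolvesBondEquation, zero_mul]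
    exact (Int.modEq_zero_iff_dvd.2 hn).symm
  · intro hn k hk hMk
    exact hn (Int.modEq_zero_iff_dvd.1
      (hk.symm.trans (Int.modEq_zero_iff_dvd.2 (Dvd.dvd.mul_right hMk _))))

end BondEquation

/-! ### Gauge transformations and the left-canonical form. -/

section Gauge

variable {σ : Type*} {D : ℕ}

theorem list_prod_ofFn_conj {R : Type*} [Monoid R] {P Q : R} (hPQ : P * Q = 1) (hQP : Q * P = 1)
    {n : ℕ} (f : Fin n → R) :
    (List.ofFn fun j => P * f j * Q).prod = P * (List.ofFn f).prod * Q := by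
  induction n with
  | zero => simp [hPQ]
  | succ n ih =>
    rw [List.ofFn_succ, List.ofFn_succ (f := f), List.prod_cons, List.prod_cons, ih]
    simp only [mul_assoc]
    rw [← mul_assoc Q P, hQP, one_mul]

theorem amplitude_gauge {P Q : Matrix (Fin D) (Fin D) ℂ} (hPQ : P * Q = 1) (hQP : Q * P = 1)
    (c : ℂ) (A : Tensor σ D) (n : ℕ) (s : Fin n → σ) :
    amplitude (fun s => c • (P * A s * Q)) n s = c ^ n * amplitude A n s := by
  rw [amplitude, amplitude, list_prod_ofFn_smul, list_prod_ofFn_conj hPQ hQP, Matrix.trace_smul,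
    Finset.prod_const, Finset.card_univ, Fintype.card_fin, smul_eq_mul, Matrix.trace_mul_comm,
    ← mul_assoc, hQP, one_mul]

variable [Fintype σ]

theorem IsSymmetric.gauge [DecidableEq σ] {r L : ℕ} {a : Fin r → ℤ}
    {U : Fin r → Matrix.unitaryGroup σ ℂ} {A : Tensor σ D} (h : IsSymmetric L a U A)
    {P Q : Matrix (Fin D) (Fin D) ℂ} (hPQ : P * Q = 1) (hQP : Q * P = 1) (c : ℂ) :
    IsSymmetric L a U fun s => c • (P * A s * Q) := by
  intro I m hm
  obtain ⟨φ, hφ⟩ := h I m hm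
  refine ⟨φ, fun s => ?_⟩
  rw [amplitude_gauge hPQ hQP, mul_left_comm, ← hφ, chainOp, chainOp, Finset.mul_sum]
  refine Finset.sum_congr rfl fun t _ => ?_
  rw [amplitude_gauge hPQ hQP, mul_left_comm]

open scoped MatrixOrder in
theorem exists_hermitian_sqrt {l : Matrix (Fin D) (Fin D) ℂ} (hl : l.PosDef) :
    ∃ S R : Matrix (Fin D) (Fin D) ℂ, Sᴴ = S ∧ Rᴴ = R ∧ S * S = l ∧ S * R = 1 ∧ R * S = 1 := by
  have hS : (CFC.sqrt l)ᴴ = CFC.sqrt l := (Matrix.nonneg_iff_posSemidef.1 (CFC.sqrt_nonneg l)).1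
  have hSS : CFC.sqrt l * CFC.sqrt l = l := CFC.sqrt_mul_sqrt_self l hl.posSemidef.nonneg
  have hunit : IsUnit (CFC.sqrt l).det := by
    have h := (Matrix.isUnit_iff_isUnit_det _).1 hl.isUnit
    rw [← hSS, Matrix.det_mul] at h
    exact isUnit_of_mul_isUnit_left h
  refine ⟨CFC.sqrt l, (CFC.sqrt l)⁻¹, hS, ?_, hSS, Matrix.mul_nonsing_inv _ hunit,
    Matrix.nonsing_inv_mul _ hunit⟩
  rw [Matrix.conjTranspose_nonsing_inv, hS]

/-- Every injective tensor can be brought into left-canonical form by a gauge transformation and a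
rescaling. -/
theorem IsInjective.exists_gauge {A : Tensor σ D} (hA : IsInjective A) :
    ∃ (c : ℂ) (P Q : Matrix (Fin D) (Fin D) ℂ), P * Q = 1 ∧ Q * P = 1 ∧
      IsInjective (fun s => c • (P * A s * Q)) ∧ IsLeftCanonical fun s => c • (P * A s * Q) := by
  obtain ⟨hD, lam, ρ, l, hlam, hρ, hl, hρf, hlf, hspec⟩ := hA
  -- Conjugating by the square root of the left eigenvector l turns that eigenvector into 1; the
  -- factor t = λ^(-1/2) makes the eigenvalue 1.
  obtain ⟨S, R, hS, hR, hSS, hSR, hRS⟩ := exists_hermitian_sqrt hl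
  set t : ℝ := (Real.sqrt lam)⁻¹ with ht
  have htt : (t : ℂ) * t * lam = 1 := by
    have : t * t * lam = 1 := by
      rw [ht, ← mul_inv, Real.mul_self_sqrt hlam.le, inv_mul_cancel₀ hlam.ne']
    exact_mod_cast this
  have hlamC : (lam : ℂ) ≠ 0 := by exact_mod_cast hlam.ne'
  have htransfer : ∀ X, transfer (fun s => (t : ℂ) • (S * A s * R)) X
      = ((t : ℂ) * t) • (S * transfer A (R * X * R) * S) := fun X => by
    simp only [transfer, Finset.mul_sum, Finset.sum_mul, Finset.smul_sum,
      Matrix.conjTranspose_smul, Matrix.conjTranspose_mul, hS, hR, Complex.star_def,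
      Complex.conj_ofReal, smul_mul_assoc, mul_smul_comm, smul_smul, mul_assoc]
  have hsand : ∀ X : Matrix (Fin D) (Fin D) ℂ, R * (S * X * S) * R = X := fun X => by
    rw [show R * (S * X * S) * R = (R * S) * X * (S * R) by simp only [mul_assoc], hRS, hSR,
      one_mul, mul_one]
  have hsand' : ∀ X : Matrix (Fin D) (Fin D) ℂ, S * (R * X * R) * S = X := fun X => by
    rw [show S * (R * X * R) * S = (S * R) * X * (R * S) by simp only [mul_assoc], hRS, hSR,
      one_mul, mul_one]
  have hcan : ∑ s, ((t : ℂ) • (S * A s * R))ᴴ * ((t : ℂ) • (S * A s * R)) = 1 := by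
    have h1 : ∑ s, ((t : ℂ) • (S * A s * R))ᴴ * ((t : ℂ) • (S * A s * R))
        = ((t : ℂ) * t) • (R * transferDual A l * R) := by
      simp only [transferDual, Finset.mul_sum, Finset.sum_mul, Finset.smul_sum, ← hSS,
        Matrix.conjTranspose_smul, Matrix.conjTranspose_mul, hS, hR, Complex.star_def,
        Complex.conj_ofReal, smul_mul_assoc, mul_smul_comm, smul_smul, mul_assoc]
    rw [h1, hlf, mul_smul_comm, smul_mul_assoc, smul_smul, htt, one_smul, ← hSS, ← mul_assoc, hRS,
      one_mul, hSR]
  refine ⟨t, S, R, hSR, hRS, ⟨hD, 1, S * ρ * S, 1, one_pos, ?_, Matrix.PosDef.one, ?_, ?_, ?_⟩,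
    hcan⟩
  · have hinj : Function.Injective S.mulVec := fun x y hxy => by
      have := congrArg R.mulVec hxy
      simpa [Matrix.mulVec_mulVec, hRS] using this
    have := hρ.conjTranspose_mul_mul_same hinj
    rwa [hS] at this
  · rw [htransfer, hsand, hρf, mul_smul_comm, smul_mul_assoc, smul_smul, htt, Complex.ofReal_one]
  · simpa [transferDual] using hcan
  · intro μ X hX hμ
    rw [htransfer] at hμ
    -- Undoing the gauge sends an eigenvector for μ to one of the original tensor for λμ, so the
    -- spectral gap carries over.
    have hY : transfer A (R * X * R) = (lam * μ) • (R * X * R) := by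
      have h1 : transfer A (R * X * R)
          = (lam : ℂ) • (R * (((t : ℂ) * t) • (S * transfer A (R * X * R) * S)) * R) := by
        rw [mul_smul_comm, smul_mul_assoc, hsand, smul_smul, mul_comm, htt, one_smul]
      rw [h1, hμ, mul_smul_comm, smul_mul_assoc, smul_smul]
    have hY0 : R * X * R ≠ 0 := fun h0 => hX (by rw [← hsand' X, h0, mul_zero, zero_mul])
    rcases hspec _ _ hY0 hY with h | ⟨h, c, hc⟩
    · left
      rw [norm_mul, Complex.norm_real, Real.norm_of_nonneg hlam.le] at h
      exact (mul_lt_iff_lt_one_right hlam).1 h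
    · right
      refine ⟨by rw [Complex.ofReal_one]; exact mul_left_cancel₀ hlamC (by rw [h, mul_one]), c, ?_⟩
      rw [← hsand' X, hc, mul_smul_comm, smul_mul_assoc]

end Gauge

/-! ### A symmetric product state for commuting generators. -/

section ProductState

/-- Induction on the operators already diagonalised, keeping a nonzero subspace invariant under the
whole family. Intersecting with an eigenspace of the next operator preserves invariance by
commutation. -/
theorem exists_common_eigenvector {V : Type*} [AddCommGroup V] [Module ℂ V]
    [FiniteDimensional ℂ V] [Nontrivial V] {ι : Type*} [Finite ι] (f : ι → Module.End ℂ V)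
    (hf : ∀ i j, Commute (f i) (f j)) : ∃ x : V, x ≠ 0 ∧ ∀ i, ∃ μ : ℂ, f i x = μ • x := by
  classical
  have := Fintype.ofFinite ι
  suffices H : ∀ s : Finset ι, ∃ W : Submodule ℂ V, W ≠ ⊥ ∧ (∀ j, ∀ x ∈ W, f j x ∈ W) ∧
      ∀ i ∈ s, ∃ μ : ℂ, ∀ x ∈ W, f i x = μ • x by
    obtain ⟨W, hW, -, hμ⟩ := H Finset.univ
    obtain ⟨x, hxW, hx⟩ := W.ne_bot_iff.1 hW
    refine ⟨x, hx, fun i => ?_⟩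
    obtain ⟨μ, h⟩ := hμ i (Finset.mem_univ i)
    exact ⟨μ, h x hxW⟩
  intro s
  induction s using Finset.induction_on with
  | empty => exact ⟨⊤, top_ne_bot, fun _ _ _ => trivial, fun i hi => absurd hi (by simp)⟩
  | insert i s _ ih =>
    obtain ⟨W, hW, hinv, hμ⟩ := ih
    have : Nontrivial W := Submodule.nontrivial_iff_ne_bot.2 hW
    obtain ⟨μ, hμi⟩ := Module.End.exists_eigenvalue ((f i).restrict (hinv i))
    obtain ⟨y, hy⟩ := hμi.exists_hasEigenvector
    refine ⟨W ⊓ (f i).eigenspace μ, ?_, fun j x hx => ⟨hinv j x hx.1, ?_⟩, fun k hk => ?_⟩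
    · refine Submodule.ne_bot_iff _ |>.2 ⟨y, ⟨y.2, ?_⟩, fun h0 => hy.2 (Subtype.ext h0)⟩
      rw [SetLike.mem_coe, Module.End.mem_eigenspace_iff]
      exact congrArg Subtype.val hy.apply_eq_smul
    · have hx2 := Module.End.mem_eigenspace_iff.1 hx.2
      rw [SetLike.mem_coe, Module.End.mem_eigenspace_iff, ← Module.End.mul_apply, (hf i j).eq,
        Module.End.mul_apply, hx2, map_smul]
    · rcases Finset.mem_insert.1 hk with rfl | hk
      · exact ⟨μ, fun x hx => Module.End.mem_eigenspace_iff.1 hx.2⟩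
      · obtain ⟨ν, hν⟩ := hμ k hk
        exact ⟨ν, fun x hx => hν x hx.1⟩

variable {σ : Type*} [Fintype σ] [DecidableEq σ] {r : ℕ}

/-- Commuting on-site unitaries admit a symmetric product state, which carries the trivial class. -/
theorem not_sptLSMObstruction_of_commute [Nonempty σ] (L : ℕ) (N : Fin r → ℕ) (a : Fin r → ℤ)
    (U : Fin r → Matrix.unitaryGroup σ ℂ) (hU : ∀ I J, Commute (U I) (U J)) :
    ¬ SPTLSMObstruction L N a U := by
  obtain ⟨x, hx, hμ⟩ := exists_common_eigenvector
    (fun I => Matrix.toLin' (U I : Matrix σ σ ℂ)) fun I J => by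
      rw [Commute, SemiconjBy, Module.End.mul_eq_comp, Module.End.mul_eq_comp, ← Matrix.toLin'_mul,
        ← Matrix.toLin'_mul, ← Matrix.UnitaryGroup.mul_val, (hU I J).eq,
        Matrix.UnitaryGroup.mul_val]
  have hpos : 0 < ∑ s, ‖x s‖ ^ 2 := by
    obtain ⟨s, hs⟩ := Function.ne_iff.1 hx
    refine Finset.sum_pos' (fun _ _ => by positivity) ⟨s, Finset.mem_univ s, ?_⟩
    have := norm_pos_iff.2 hs
    positivity
  set t : ℝ := (Real.sqrt (∑ s, ‖x s‖ ^ 2))⁻¹ with ht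
  -- The normalised common eigenvector as a tensor of bond dimension one; its transfer map is the
  -- identity and the bond unitaries can be taken to be 1.
  set A : Tensor σ 1 := fun s => ((t : ℂ) * x s) • 1 with hA
  have hnorm : ∑ s, star ((t : ℂ) * x s) * ((t : ℂ) * x s) = 1 := by
    have h1 : ∀ s, star ((t : ℂ) * x s) * ((t : ℂ) * x s) = ((t * t * ‖x s‖ ^ 2 : ℝ) : ℂ) :=
      fun s => by
        rw [mul_comm, Complex.star_def, Complex.mul_conj, Complex.normSq_eq_norm_sq, norm_mul,
          mul_pow, Complex.norm_real, Real.norm_eq_abs, sq_abs, sq t]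
    simp only [h1]
    rw [← Complex.ofReal_sum, ← Finset.mul_sum, ht, ← mul_inv, Real.mul_self_sqrt hpos.le,
      inv_mul_cancel₀ hpos.ne', Complex.ofReal_one]
  have htransfer : ∀ X, transfer A X = X := fun X => by
    simp only [transfer, hA, Matrix.conjTranspose_smul, Matrix.conjTranspose_one, smul_mul_assoc,
      mul_smul_comm, one_mul, mul_one, smul_smul, ← Finset.sum_smul, hnorm, one_smul]
  have hdual : ∀ X, transferDual A X = X := fun X => by
    simp only [transferDual, hA, Matrix.conjTranspose_smul, Matrix.conjTranspose_one,
      smul_mul_assoc, mul_smul_comm, one_mul, mul_one, smul_smul, ← Finset.sum_smul,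
      mul_comm _ (star _), hnorm, one_smul]
  have hcan : IsLeftCanonical A := by
    have := hdual 1
    simpa [transferDual, IsLeftCanonical] using this
  have hinj : IsInjective A := by
    refine ⟨one_pos, 1, 1, 1, one_pos, Matrix.PosDef.one, Matrix.PosDef.one, by simp [htransfer],
      by simp [hdual], fun μ X hX h => Or.inr ⟨?_, X 0 0, ?_⟩⟩
    · rw [htransfer] at h
      have h2 : (1 - μ) • X = 0 := by rw [sub_smul, one_smul, ← h, sub_self]
      rw [Complex.ofReal_one]
      exact (sub_eq_zero.1 ((smul_eq_zero.1 h2).resolve_right hX)).symm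
    · ext i j
      fin_cases i
      fin_cases j
      simp
  have hact : ∀ I, ∃ φ : Circle, (φ, U I, 1, 1) ∈ pushGroup A := fun I => by
    obtain ⟨μ, hμI⟩ := hμ I
    have h1 : ∀ s, act (U I : Matrix σ σ ℂ) A s = μ • A s := fun s => by
      have h2 := congrFun hμI s
      rw [Matrix.toLin'_apply, Matrix.mulVec, dotProduct, Pi.smul_apply, smul_eq_mul] at h2
      simp only [act, hA, smul_smul, mul_left_comm _ (t : ℂ)]
      rw [← Finset.sum_smul, ← Finset.mul_sum, h2]
    have h2 : ‖μ‖ = 1 := by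
      have h3 := transfer_act (U I).2 A 1
      rw [show act (U I : Matrix σ σ ℂ) A = fun s => μ • A s from funext h1] at h3
      have h4 : transfer (fun s => μ • A s) 1 = (μ * star μ) • transfer A 1 := by
        simp only [transfer, Matrix.conjTranspose_smul, smul_mul_assoc, mul_smul_comm, smul_smul,
          Finset.smul_sum, mul_comm (star μ)]
      rw [h4, htransfer] at h3
      have h5 := congrFun (congrFun h3 0) 0
      simp only [Matrix.smul_apply, Matrix.one_apply_eq, smul_eq_mul, mul_one] at h5
      have h6 := congrArg norm h5
      rw [norm_mul, norm_star, norm_one] at h6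
      nlinarith [norm_nonneg μ]
    obtain ⟨φ, hφ⟩ : ∃ φ : Circle, (φ : ℂ) = μ := ⟨⟨μ, mem_sphere_zero_iff_norm.2 h2⟩, rfl⟩
    refine ⟨φ, mem_pushGroup.2 fun s => ?_⟩
    rw [h1, hφ]
    simp
  choose φ hφ using hact
  have hpow : ∀ I (k : ℤ), (φ I ^ k, U I ^ k, 1, 1) ∈ pushGroup A := fun I k => by
    have := (pushGroup A).zpow_mem (hφ I) k
    rwa [Prod.pow_mk, Prod.pow_mk, Prod.pow_mk, one_zpow] at this
  have hsym : IsSymmetric L a U A := fun I m hm => by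
    refine ⟨∏ j : Fin (m * L), φ I ^ (a I ^ ((j : ℕ) % L)), fun s => ?_⟩
    have h1 : ∀ j : Fin (m * L), act (siteOp (U I) (a I) ((j : ℕ) % L)) A (s j)
        = ((φ I ^ (a I ^ ((j : ℕ) % L)) : Circle) : ℂ) • A (s j) := fun j => by
      have := mem_pushGroup.1 (hpow I (a I ^ ((j : ℕ) % L))) (s j)
      simpa [siteOp] using this
    rw [chainOp_amplitude]
    simp only [h1]
    rw [list_prod_ofFn_smul, Matrix.trace_smul, smul_eq_mul, amplitude]
    congr 1
    exact (map_prod Circle.coeHom (fun j : Fin (m * L) => φ I ^ (a I ^ ((j : ℕ) % L))) _).symm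
  intro h
  refine h 1 A hinj hcan hsym 1 (pushesThrough_iff.2 fun I j => ⟨_, by
    simpa using hpow I (a I ^ j)⟩) 0 1 (fun g h => ?_) ⟨1, fun g h => by simp⟩
  have hone : ∀ g, bondOp N a (1 : Fin r → Matrix.unitaryGroup (Fin 1) ℂ) 0 g = 1 := fun g => by
    simp [bondOp]
  simp [hone]

end ProductState

/-! ### Bond class versus cohomology class. -/

section Coboundary

variable {D r : ℕ}

/-- A nonzero bond class forbids trivial cocycles. -/
theorem IsBondClass.not_isCoboundary {N : Fin r → ℕ} {a : Fin r → ℤ}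
    {v : Fin r → Matrix.unitaryGroup (Fin D) ℂ} {I J : Fin r} {M : ℕ} {k : ℤ} (hM : 0 < M)
    (hI : IsCoprime (a I) (M : ℤ)) (hJ : IsCoprime (a J) (M : ℤ))
    (hk : IsBondClass N a v I J M k) (hMk : ¬ (M : ℤ) ∣ k) (j : ℕ)
    {ω : (∀ K, ZMod (N K)) → (∀ K, ZMod (N K)) → Circle} (hω : HasCocycle (bondOp N a v j) ω) :
    ¬ IsCoboundary ω := by
  rintro ⟨β, hβ⟩
  have h := (hk j).2 ω hω
  -- A coboundary on an abelian group is symmetric, so the commutator phase is 1 and M divides k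
  -- (a_I a_J)^j. The powers of a_I a_J are units modulo M and can be cancelled.
  rw [hβ, hβ, mul_comm (β (Pi.single I 1)), add_comm, mul_inv_cancel, eq_comm,
    rootPhase_eq_one_iff hM] at h
  exact hMk ((hI.mul_left hJ).pow_left.symm.dvd_of_dvd_mul_right h)

end Coboundary

/-! ### Obstructions for exponential symmetry systems. -/

section System

variable {σ : Type*} [Fintype σ] [DecidableEq σ] {r L : ℕ} {N : Fin r → ℕ} {a : Fin r → ℤ}
  {n : Fin r → Fin r → ℤ} {U : Fin r → Matrix.unitaryGroup σ ℂ}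

/-- Exponential symmetries generating `∏ ℤ/N_I` that act projectively on each site. -/
structure IsExponentialSystem (L : ℕ) (N : Fin r → ℕ) (a : Fin r → ℤ) (n : Fin r → Fin r → ℤ)
    (U : Fin r → Matrix.unitaryGroup σ ℂ) : Prop where
  length_pos : 0 < L
  order_pos : ∀ I, 0 < N I
  coprime : ∀ I, IsCoprime (a I) (N I : ℤ)
  pow_order : ∀ I, EqPhase ((U I ^ N I : Matrix.unitaryGroup σ ℂ) : Matrix σ σ ℂ) 1
  periodic : ∀ I, IsPeriodic L (U I) (a I)
  commutator : ∀ I J, I < J → (U I : Matrix σ σ ℂ) * (U J : Matrix σ σ ℂ) =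
    (rootPhase (Nat.gcd (N I) (N J)) (n I J) : ℂ) • ((U J : Matrix σ σ ℂ) * (U I : Matrix σ σ ℂ))

namespace IsExponentialSystem

theorem pow_eq_scalar (h : IsExponentialSystem L N a n U) (I : Fin r) :
    ∃ c, U I ^ N I = scalarUnitary σ c := by
  obtain ⟨c, hc⟩ := eqPhase_iff (y := 1).1 (h.pow_order I)
  exact ⟨c, by rw [hc, mul_one]⟩

theorem mul_eq_scalar_mul (h : IsExponentialSystem L N a n U) {I J : Fin r} (hIJ : I < J) :
    U I * U J = scalarUnitary σ (rootPhase (Nat.gcd (N I) (N J)) (n I J)) * (U J * U I) :=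
  eq_scalarUnitary_mul_iff.2 (h.commutator I J hIJ)

theorem exists_scalar_commutator (h : IsExponentialSystem L N a n U) (I J : Fin r) :
    ∃ c, U I * U J = scalarUnitary σ c * (U J * U I) := by
  rcases lt_trichotomy I J with hIJ | rfl | hIJ
  · exact ⟨_, h.mul_eq_scalar_mul hIJ⟩
  · exact ⟨1, by rw [map_one, one_mul]⟩
  · refine ⟨(rootPhase (Nat.gcd (N J) (N I)) (n J I))⁻¹, ?_⟩
    rw [h.mul_eq_scalar_mul hIJ, map_inv, inv_mul_cancel_left]

theorem gcd_pos (h : IsExponentialSystem L N a n U) (I J : Fin r) : 0 < Nat.gcd (N I) (N J) :=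
  Nat.gcd_pos_of_pos_left _ (h.order_pos I)

theorem symmetric_mps (h : IsExponentialSystem L N a n U) {D : ℕ} {A : Tensor σ D}
    (hinj : IsInjective A) (hcan : IsLeftCanonical A) (hsym : IsSymmetric L a U A) :
    (∃ v : Fin r → Matrix.unitaryGroup (Fin D) ℂ, PushesThrough a U A v) ∧
    (∀ v : Fin r → Matrix.unitaryGroup (Fin D) ℂ, PushesThrough a U A v →
      ∀ j : ℕ, ∃ ω, HasCocycle (bondOp N a v j) ω) ∧
    ∀ I J, I < J → ∃ k : ℤ,
      SolvesBondEquation (Nat.gcd (N I) (N J)) (a I * a J) (n I J) k ∧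
      ∀ v : Fin r → Matrix.unitaryGroup (Fin D) ℂ, PushesThrough a U A v →
        IsBondClass N a v I J (Nat.gcd (N I) (N J)) k := by
  obtain ⟨ρ, hρ⟩ := exists_isStationary hinj hcan
  obtain ⟨v, hv⟩ := hρ.exists_pushesThrough h.length_pos h.periodic hsym
  refine ⟨⟨v, hv⟩, fun v hv j => ?_, fun I J hIJ => ?_⟩
  · exact exists_hasCocycle h.order_pos a (fun I => hρ.bond_pow_eq_scalar hv (h.pow_eq_scalar I))
      (fun I J => hρ.bond_commutator_scalar hv (h.exists_scalar_commutator I J)) j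
  · exact hρ.exists_bondClass h.order_pos (h.pow_eq_scalar I) (h.pow_eq_scalar J)
      (h.mul_eq_scalar_mul hIJ) hv

theorem lsmObstruction (h : IsExponentialSystem L N a n U) {I J : Fin r} (hIJ : I < J)
    (hn : ¬ (Int.gcd (a I * a J - 1) (Nat.gcd (N I) (N J) : ℕ) : ℤ) ∣ n I J) :
    LSMObstruction L a U := by
  intro D A hinj hsym
  obtain ⟨c, P, Q, hPQ, hQP, hinj', hcan'⟩ := hinj.exists_gauge
  obtain ⟨k, hk, -⟩ := (h.symmetric_mps hinj' hcan' (hsym.gauge hPQ hQP c)).2.2 I J hIJ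
  exact hn (exists_solvesBondEquation_iff.1 ⟨k, hk⟩)

theorem sptLSMObstruction (h : IsExponentialSystem L N a n U) {I J : Fin r} (hIJ : I < J)
    (hk : ∀ k : ℤ, SolvesBondEquation (Nat.gcd (N I) (N J)) (a I * a J) (n I J) k →
      ¬ ((Nat.gcd (N I) (N J) : ℕ) : ℤ) ∣ k) :
    SPTLSMObstruction L N a U := by
  intro D A hinj hcan hsym v hv j ω hω
  obtain ⟨k, hk1, hk2⟩ := (h.symmetric_mps hinj hcan hsym).2.2 I J hIJ
  refine (hk2 v hv).not_isCoboundary (h.gcd_pos I J) ?_ ?_ (hk k hk1) j hω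
  · exact (h.coprime I).of_isCoprime_of_dvd_right (by exact_mod_cast Nat.gcd_dvd_left _ _)
  · exact (h.coprime J).of_isCoprime_of_dvd_right (by exact_mod_cast Nat.gcd_dvd_right _ _)

/-- If every n_IJ vanishes modulo N_IJ, the generators commute exactly and the product state refutes
the obstruction; otherwise no solution of the bond equation for that pair vanishes. -/
theorem sptLSMObstruction_iff [Nonempty σ] (h : IsExponentialSystem L N a n U) :
    SPTLSMObstruction L N a U ↔ ∃ I J, I < J ∧ ¬ ((Nat.gcd (N I) (N J) : ℕ) : ℤ) ∣ n I J := by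
  constructor
  · intro hspt
    by_contra! hn
    have hcomm : ∀ I J, I < J → Commute (U I) (U J) := fun I J hIJ => by
      have := h.mul_eq_scalar_mul hIJ
      rwa [(rootPhase_eq_one_iff (h.gcd_pos I J) _).2 (hn I J hIJ), map_one, one_mul] at this
    refine not_sptLSMObstruction_of_commute L N a U (fun I J => ?_) hspt
    rcases lt_trichotomy I J with hIJ | rfl | hIJ
    · exact hcomm I J hIJ
    · exact Commute.refl _
    · exact (hcomm J I hIJ).symm
  · rintro ⟨I, J, hIJ, hn⟩
    exact h.sptLSMObstruction hIJ (forall_solution_not_dvd_iff.2 hn)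

end IsExponentialSystem

end System

/-! ### The clock and shift chain. -/

section Qudit

variable (N : ℕ) [NeZero N]

theorem shift_pow_apply (k : ℕ) (s t : ZMod N) :
    ((shift N ^ k : Matrix.unitaryGroup (ZMod N) ℂ) : Matrix (ZMod N) (ZMod N) ℂ) s t
      = if s = t + k then 1 else 0 := by
  induction k generalizing s with
  | zero => simp [Matrix.one_apply]
  | succ k ih =>
    rw [pow_succ', Matrix.UnitaryGroup.mul_apply]
    have hs : ∀ x, (shift N : Matrix (ZMod N) (ZMod N) ℂ) s x = if s = x + 1 then 1 else 0 :=
      fun _ => rfl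
    simp only [hs, ih, Matrix.mul_apply]
    rw [Finset.sum_eq_single (t + k)]
    · simp [add_assoc]
    · intro x _ hx
      simp [hx]
    · simp

theorem shift_pow_self : shift N ^ N = 1 :=
  Subtype.ext (Matrix.ext fun s t => by rw [shift_pow_apply]; simp [Matrix.one_apply])

theorem clock_pow_self : clock N ^ N = 1 := by
  refine Subtype.ext ?_
  have h : ((clock N ^ N : Matrix.unitaryGroup (ZMod N) ℂ) : Matrix (ZMod N) (ZMod N) ℂ)
      = clockMatrix N ^ N := rfl
  rw [h, clockMatrix, Matrix.diagonal_pow, Matrix.UnitaryGroup.one_val, ← Matrix.diagonal_one]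
  congr 1
  funext s
  have h1 : rootPhase N (s.val : ℤ) ^ N = 1 := by
    rw [← zpow_natCast, rootPhase_zpow, rootPhase_eq_one_iff (NeZero.pos N)]
    exact dvd_mul_left _ _
  rw [Pi.pow_apply, ← Circle.coe_pow, h1, Circle.coe_one]

theorem clock_mul_shift :
    clock N * shift N = scalarUnitary (ZMod N) (rootPhase N 1) * (shift N * clock N) := by
  rw [eq_scalarUnitary_mul_iff]
  ext s t
  simp only [clock, shift, clockMatrix, shiftMatrix, Matrix.UnitaryGroup.mul_val,
    Matrix.diagonal_mul, Matrix.mul_diagonal, Matrix.smul_apply, Matrix.of_apply, smul_eq_mul]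
  by_cases hst : s = t + 1
  · rw [if_pos hst, mul_one, one_mul, ← Circle.coe_mul, ← rootPhase_add, hst]
    -- The representative of t + 1 may wrap around to 0, so the exponents agree only modulo N, which
    -- suffices for the phase.
    refine congrArg _ ((rootPhase_eq_iff (NeZero.pos N) _ _).2 ?_)
    rw [← ZMod.intCast_eq_intCast_iff]
    push_cast
    rw [ZMod.natCast_zmod_val, ZMod.natCast_zmod_val, add_comm]
  · rw [if_neg hst, mul_zero, zero_mul, mul_zero]

/-- The qudit chain is an exponential system with two generators. -/
theorem isExponentialSystem_qudit {N : ℕ} [NeZero N] {a b n : ℤ} {L : ℕ} (hL : 0 < L)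
    (ha : IsCoprime a (N : ℤ)) (hb : IsCoprime b (N : ℤ)) (hX : IsPeriodic L (shift N) a)
    (hZ : IsPeriodic L (clock N ^ n) b) :
    IsExponentialSystem L (fun _ : Fin 2 => N) ![b, a] (fun _ _ => n) (quditGen N n) where
  length_pos := hL
  order_pos _ := NeZero.pos N
  coprime I := by fin_cases I <;> assumption
  pow_order I := by
    have h : quditGen N n I ^ N = 1 := by
      fin_cases I
      · change (clock N ^ n) ^ N = 1
        rw [← zpow_natCast, zpow_comm, zpow_natCast, clock_pow_self, one_zpow]
      · exact shift_pow_self N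
    exact ⟨1, by simp [h]⟩
  periodic I := by fin_cases I <;> assumption
  commutator I J hIJ := by
    obtain ⟨rfl, rfl⟩ : I = 0 ∧ J = 1 := by omega
    rw [← Matrix.UnitaryGroup.mul_val, ← Matrix.UnitaryGroup.mul_val, ← eq_scalarUnitary_mul_iff,
      Nat.gcd_self]
    have h := zpow_mul_zpow_of_commutator (scalarUnitary_commute _) (clock_mul_shift N) n 1
    rw [← map_zpow, rootPhase_zpow, one_mul, mul_one, zpow_one] at h
    exact h

end Qudit

end ModulatedMPS

open ModulatedMPS
theorem mainTheorem6 :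
    -- the equation `k (q - 1) ≡ n (mod M)`, with `q = ab` and `c = gcd (q - 1, M)`
    (∀ (M : ℕ) (q n : ℤ), 0 < M →
      ((∃ k : ℤ, SolvesBondEquation M q n k) ↔ (Int.gcd (q - 1) M : ℤ) ∣ n) ∧
      ((Int.gcd (q - 1) M : ℤ) ∣ n →
        (∃ u : ℤ, u * ((q - 1) / (Int.gcd (q - 1) M : ℤ)) ≡ 1
          [ZMOD (M : ℤ) / (Int.gcd (q - 1) M : ℤ)]) ∧
        ∀ u : ℤ, u * ((q - 1) / (Int.gcd (q - 1) M : ℤ)) ≡ 1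
          [ZMOD (M : ℤ) / (Int.gcd (q - 1) M : ℤ)] →
          ∀ k : ℤ, SolvesBondEquation M q n k ↔
            ∃! τ : ℕ, τ < Int.gcd (q - 1) M ∧
              k ≡ n / (Int.gcd (q - 1) M : ℤ) * u + τ * ((M : ℤ) / (Int.gcd (q - 1) M : ℤ))
                [ZMOD (M : ℤ)]) ∧
      (Int.gcd (q - 1) M = 1 →
        ((∀ k : ℤ, SolvesBondEquation M q n k → ¬ (M : ℤ) ∣ k) ↔ ¬ (M : ℤ) ∣ n))) ∧
    -- the qudit chain with the symmetries `⊗ Z ^ (n b ^ j)` and `⊗ X ^ (a ^ j)`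
    (∀ (N : ℕ) [NeZero N] (a b n : ℤ) (L : ℕ), 0 < L →
      IsCoprime a (N : ℤ) → IsCoprime b (N : ℤ) →
      IsPeriodic L (shift N) a →
      IsPeriodic L (clock N ^ n) b →
      (∀ (D : ℕ) (A : Tensor (ZMod N) D),
        IsInjective A → IsLeftCanonical A →
        IsSymmetric L ![b, a] (quditGen N n) A →
        (∃ v : Fin 2 → Matrix.unitaryGroup (Fin D) ℂ,
          PushesThrough ![b, a] (quditGen N n) A v) ∧
        (∀ v : Fin 2 → Matrix.unitaryGroup (Fin D) ℂ,
          PushesThrough ![b, a] (quditGen N n) A v →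
          ∀ j : ℕ, ∃ ω, HasCocycle
            (bondOp (fun _ : Fin 2 => N) ![b, a] v j) ω) ∧
        ∃ k : ℤ, SolvesBondEquation N (a * b) n k ∧
          ∀ v : Fin 2 → Matrix.unitaryGroup (Fin D) ℂ,
            PushesThrough ![b, a] (quditGen N n) A v →
            IsBondClass (fun _ : Fin 2 => N) ![b, a] v 0 1 N k) ∧
      (¬ (Int.gcd (a * b - 1) N : ℤ) ∣ n →
        LSMObstruction L ![b, a] (quditGen N n)) ∧
      ((∀ k : ℤ, SolvesBondEquation N (a * b) n k → ¬ (N : ℤ) ∣ k) →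
        SPTLSMObstruction L (fun _ : Fin 2 => N) ![b, a]
          (quditGen N n)) ∧
      (Int.gcd (a * b - 1) N = 1 →
        (SPTLSMObstruction L (fun _ : Fin 2 => N) ![b, a]
          (quditGen N n) ↔ ¬ (N : ℤ) ∣ n))) ∧
    -- a general finite Abelian group `∏ ℤ/N_I`, acting projectively on each site
    (∀ (σ : Type*) [Fintype σ] [DecidableEq σ] [Nonempty σ] (r : ℕ) (N : Fin r → ℕ)
      (a : Fin r → ℤ) (n : Fin r → Fin r → ℤ) (U : Fin r → Matrix.unitaryGroup σ ℂ) (L : ℕ),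
      0 < L → (∀ I, 0 < N I) → (∀ I, IsCoprime (a I) (N I : ℤ)) →
      (∀ I, EqPhase ((U I ^ N I : Matrix.unitaryGroup σ ℂ) : Matrix σ σ ℂ) 1) →
      (∀ I, IsPeriodic L (U I) (a I)) →
      (∀ I J, I < J → (U I : Matrix σ σ ℂ) * (U J : Matrix σ σ ℂ) =
        (rootPhase (Nat.gcd (N I) (N J)) (n I J) : ℂ) •
          ((U J : Matrix σ σ ℂ) * (U I : Matrix σ σ ℂ))) →
      (∀ (D : ℕ) (A : Tensor σ D),
        IsInjective A → IsLeftCanonical A →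
        IsSymmetric L a U A →
        (∃ v : Fin r → Matrix.unitaryGroup (Fin D) ℂ, PushesThrough a U A v) ∧
        (∀ v : Fin r → Matrix.unitaryGroup (Fin D) ℂ, PushesThrough a U A v →
          ∀ j : ℕ, ∃ ω, HasCocycle (bondOp N a v j) ω) ∧
        ∀ I J, I < J → ∃ k : ℤ,
          SolvesBondEquation (Nat.gcd (N I) (N J)) (a I * a J) (n I J) k ∧
          ∀ v : Fin r → Matrix.unitaryGroup (Fin D) ℂ, PushesThrough a U A v →
            IsBondClass N a v I J (Nat.gcd (N I) (N J)) k) ∧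
      ((∃ I J, I < J ∧
          ¬ (Int.gcd (a I * a J - 1) (Nat.gcd (N I) (N J) : ℕ) : ℤ) ∣ n I J) →
        LSMObstruction L a U) ∧
      ((∃ I J, I < J ∧ ∀ k : ℤ,
          SolvesBondEquation (Nat.gcd (N I) (N J)) (a I * a J) (n I J) k →
            ¬ ((Nat.gcd (N I) (N J) : ℕ) : ℤ) ∣ k) →
        SPTLSMObstruction L N a U) ∧
      ((∀ I J, I < J → Int.gcd (a I * a J - 1) (Nat.gcd (N I) (N J) : ℕ) = 1) →
        (SPTLSMObstruction L N a U ↔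
          ∃ I J, I < J ∧ ¬ ((Nat.gcd (N I) (N J) : ℕ) : ℤ) ∣ n I J))) := by
  refine ⟨fun M q n hM => ⟨exists_solvesBondEquation_iff, fun hn => ⟨exists_inverse_mod hM q,
    fun u hu k => solvesBondEquation_iff_existsUnique hM hn hu k⟩,
    fun _ => forall_solution_not_dvd_iff⟩, ?_, ?_⟩
  · intro N _ a b n L hL ha hb hX hZ
    have h := isExponentialSystem_qudit hL ha hb hX hZ
    have hba : (![b, a] : Fin 2 → ℤ) 0 * (![b, a] : Fin 2 → ℤ) 1 = a * b := mul_comm b a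
    have h01 : (0 : Fin 2) < 1 := Fin.zero_lt_one
    refine ⟨fun D A hinj hcan hsym => ?_, fun hn => ?_, fun hk => ?_, fun _ => ?_⟩
    · obtain ⟨h1, h2, h3⟩ := h.symmetric_mps hinj hcan hsym
      refine ⟨h1, h2, ?_⟩
      have h4 := h3 0 1 h01
      rwa [Nat.gcd_self, hba] at h4
    · refine h.lsmObstruction h01 ?_
      rwa [Nat.gcd_self, hba]
    · refine h.sptLSMObstruction h01 ?_
      rwa [Nat.gcd_self, hba]
    · rw [h.sptLSMObstruction_iff]
      simp only [Nat.gcd_self]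
      exact ⟨fun ⟨_, _, _, hn⟩ => hn, fun hn => ⟨0, 1, h01, hn⟩⟩
  · intro σ _ _ _ r N a n U L hL hN ha hpow hper hcomm
    have h : IsExponentialSystem L N a n U := ⟨hL, hN, ha, hpow, hper, hcomm⟩
    exact ⟨fun D A => h.symmetric_mps, fun ⟨I, J, hIJ, hn⟩ => h.lsmObstruction hIJ hn,
      fun ⟨I, J, hIJ, hk⟩ => h.sptLSMObstruction hIJ hk, fun _ => h.sptLSMObstruction_iff⟩
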